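/- Let $k$ be a positive even integer and $N\in\{18,20,24\}$. Let $(a_n)_{n\ge 1}$ be a complex sequence with $a_n=O(n^{\sigma})$ for some real $\sigma>0$, and for $\Re(s)>\sigma+1$ put $L_f(s)=\sum_{n=1}^{\infty}a_n n^{-s}$. Suppose that for $\Re(s)>\sigma+1$ there is an Euler product expansion $$L_f(s)=\prod_{p\nmid N}\left(1-a_p p^{-s}+p^{k-1-2s}\right)^{-1}\prod_{\substack{p\mid N\\ p^2\nmid N}}\left(1-p^{k/2-1-s}\right)^{-1},$$ the products being over primes. Define $\Lambda_f(s)=\Gamma_{\mathbb C}(s)L_f(s)$, where $\Gamma_{\mathbb C}(s)=(2\pi)^{-s}\Gamma(s)$, and suppose that $\Lambda_f$ admits an extension to an entire function on $\mathbb{C}$ which is bounded on every vertical strip (of finite width) and satisfies, for all $s\in\mathbb C$, the functional equation $$\Lambda_f(s)=(-1)^{k/2}N^{k/2-s}\Lambda_f(k-s).$$ Then $$f(z)=\sum_{n=1}^{\infty}a_n e^{2\pi i n z}\qquad(\Im z>0)$$ is a modular form of weight $k$ on $\Gamma_0(N)$ (holomorphic on the upper half-plane and at the cusps). -/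

import Mathlib

open scoped MatrixGroups

/-- `F` is EBV: entire and bounded on every vertical strip `α ≤ Re s ≤ β`. -/
def IsEBV (F : ℂ → ℂ) : Prop :=
  Differentiable ℂ F ∧
    ∀ α β : ℝ, ∃ C : ℝ, ∀ s : ℂ, α ≤ s.re → s.re ≤ β → ‖F s‖ ≤ C

/-- `Γ_ℂ(s) = (2π)^{-s} Γ(s)`; no factor `2`, unlike `Complex.Gammaℂ`. -/
noncomputable def gammaC (s : ℂ) : ℂ :=
  (2 * (Real.pi : ℂ)) ^ (-s) * Complex.Gamma s

/-- The factor at the prime `p` of the weight `k`, level `N` Euler product with coefficients `a`: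
`(1 - a_p p^{-s} + p^{k-1-2s})⁻¹` if `p ∤ N`, `(1 - p^{k/2-1-s})⁻¹` if `p ∣ N` and `p² ∤ N`,
and `1` if `p² ∣ N`. -/
noncomputable def eulerFactor (N k : ℕ) (a : ℕ → ℂ) (p : ℕ) (s : ℂ) : ℂ :=
  if ¬ p ∣ N then
    (1 - a p * (p : ℂ) ^ (-s) + (p : ℂ) ^ ((k : ℂ) - 1 - 2 * s))⁻¹
  else if ¬ p ^ 2 ∣ N then
    (1 - (p : ℂ) ^ ((k : ℂ) / 2 - 1 - s))⁻¹
  else 1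

/-!
Write `k = 2m`, `f ∣ A = det(A)^m (cz + d)^{-2m} f(Az)` for integral matrices `A` of positive
determinant, `T = (1, 1; 0, 1)` and `W_M = (0, -1; M, 0)`. The hypotheses yield three kinds of
relations for `f`, and these alone force invariance under `Γ₀(N)`.

* By Hecke's argument the functional equation says `f ∣ W_N = f`: `Λ` is the Mellin transform of `f`
  on the imaginary axis, it decays in vertical strips by Phragmén–Lindelöf, and the contour in the
  inversion formula can be moved from `Re s = c` to `Re s = k - c`
  (`PolyGrowth.intSlash_fricke`).
* The Euler product makes the coefficients multiplicative with the usual recursions at prime powers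
  (`coeff_prime_mul`). So `f` is an eigenfunction of the Hecke operator `T_p` for `p ∤ N`, is fixed
  by `U_p` for `p ∥ N`, and has `a_{pn} = 0` for `p² ∣ N`; the last condition says that the sum of
  the translates of `f` by `b / p` vanishes.
* `f ∣ T = f`, as `f` is a `q`-series.

For `N = 20` and `N = 24` the dilate `g(z) = f(z / 2)`, up to a constant, satisfies `g ∣ T = -g` and
`g ∣ W_M = g` with `M = N / 4`. By Euclid's algorithm `Γ₀(5)` (resp. `Γ₀(6)`) is generated by
`-1`, `T`, `(1, 0; M, 1)`, which is conjugate to `T⁻¹` by `W_M`, and one more element (for `M = 5`,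
also its conjugate by `W₅`). The relation for `T₃` (resp. `T₅`) shows that the failure `h` of `g` to
transform correctly under that element is multiplied by a sign under an elliptic matrix of infinite
order; comparing leading terms at the fixed point, as Weil did, gives `h = 0`
(`Holo.eq_zero_of_elliptic`). Hence `g` transforms under `Γ₀(M)` by
a quadratic character, which is trivial on the conjugate of `Γ₀(N)`.

For `N = 18` the dilate `g(z) = f(z / 3)` satisfies `g + g ∣ T + g ∣ T² = 0` and `g ∣ W₂ = g`.
Comparing `U₂` with its conjugate by `W_18` gives the action of an Atkin–Lehner matrix at `9`, and
then `g`, `g ∣ T` and `g ∣ T W₂` are differences of four functions which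
`Γ₀(2) = ⟨-1, T, W₂ T W₂⁻¹⟩` permutes, up to a common summand, as it permutes the points of `ℙ¹(𝔽₃)`
(`intSlash_eq_of_level_two`). The matrices of determinant one that are diagonal modulo `3` are `±1`
modulo `3`, hence fix every point.

At a cusp, `f ∣ γ` is holomorphic, `N`-periodic and of polynomial growth, so its singularity in
`exp(2πiz/N)` is removable (`Holo.isBoundedAtImInfty`).
-/

namespace HeckeConverse

section

open UpperHalfPlane hiding I
open Complex

/-! ### The slash action of integral matrices -/

/-- The weight `2m` action of an integral matrix on functions on the upper half-plane, in the
normalization `(f ∣ A)(z) = det(A)^m (cz + d)^{-2m} f(Az)`, for which non-zero scalar matrices act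
trivially. Only matrices of positive determinant are meaningful: for them the argument of
`ofComplex` lies in the upper half-plane. -/
noncomputable def intSlash (m : ℕ) (A : Matrix (Fin 2) (Fin 2) ℤ) : (ℍ → ℂ) →ₗ[ℂ] (ℍ → ℂ) where
  toFun f z := (A.det : ℂ) ^ m / ((A 1 0 : ℂ) * z + A 1 1) ^ (2 * m) *
    f (ofComplex (((A 0 0 : ℂ) * z + A 0 1) / ((A 1 0 : ℂ) * z + A 1 1)))
  map_add' f g := by ext z; simp [mul_add]
  map_smul' c f := by ext z; simp; ring

lemma intSlash_apply (m : ℕ) (A : Matrix (Fin 2) (Fin 2) ℤ) (f : ℍ → ℂ) (z : ℍ) :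
    intSlash m A f z = (A.det : ℂ) ^ m / ((A 1 0 : ℂ) * z + A 1 1) ^ (2 * m) *
    f (ofComplex (((A 0 0 : ℂ) * z + A 0 1) / ((A 1 0 : ℂ) * z + A 1 1))) := rfl

lemma denom_ne_zero_of_det_pos {A : Matrix (Fin 2) (Fin 2) ℤ} (hA : 0 < A.det) {z : ℂ}
    (hz : 0 < z.im) : (A 1 0 : ℂ) * z + A 1 1 ≠ 0 := by
  intro h
  have h1 := congrArg Complex.im h
  have h2 := congrArg Complex.re h
  simp at h1 h2
  rw [Matrix.det_fin_two] at hA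
  rcases h1 with h1 | h1
  · simp [h1] at h2
    simp [h1, h2] at hA
  · exact hz.ne' h1

lemma im_moebius {A : Matrix (Fin 2) (Fin 2) ℤ} (hA : 0 < A.det) {z : ℂ} (hz : 0 < z.im) :
    (((A 0 0 : ℂ) * z + A 0 1) / ((A 1 0 : ℂ) * z + A 1 1)).im =
      A.det * z.im / Complex.normSq ((A 1 0 : ℂ) * z + A 1 1) := by
  have h := denom_ne_zero_of_det_pos hA hz
  have h' := Complex.normSq_pos.mpr h
  rw [Complex.div_im, Matrix.det_fin_two]
  field_simp
  simp
  ring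

lemma im_moebius_pos {A : Matrix (Fin 2) (Fin 2) ℤ} (hA : 0 < A.det) {z : ℂ} (hz : 0 < z.im) :
    0 < (((A 0 0 : ℂ) * z + A 0 1) / ((A 1 0 : ℂ) * z + A 1 1)).im := by
  have h' := Complex.normSq_pos.mpr (denom_ne_zero_of_det_pos hA hz)
  have : (0 : ℝ) < A.det := by exact_mod_cast hA
  rw [im_moebius hA hz]
  positivity

lemma coe_ofComplex_moebius {A : Matrix (Fin 2) (Fin 2) ℤ} (hA : 0 < A.det) (z : ℍ) :
    ((ofComplex (((A 0 0 : ℂ) * z + A 0 1) / ((A 1 0 : ℂ) * z + A 1 1)) : ℍ) : ℂ) =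
      ((A 0 0 : ℂ) * z + A 0 1) / ((A 1 0 : ℂ) * z + A 1 1) := by
  rw [ofComplex_apply_of_im_pos (im_moebius_pos hA z.2)]

lemma intSlash_intSlash (m : ℕ) {A B : Matrix (Fin 2) (Fin 2) ℤ} (hA : 0 < A.det) (hB : 0 < B.det)
    (f : ℍ → ℂ) : intSlash m B (intSlash m A f) = intSlash m (A * B) f := by
  ext z
  have hAB : 0 < (A * B).det := by rw [Matrix.det_mul]; positivity
  have hB0 := denom_ne_zero_of_det_pos hB z.2
  have hAB0 := denom_ne_zero_of_det_pos hAB z.2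
  rw [intSlash_apply, intSlash_apply, intSlash_apply]
  rw [coe_ofComplex_moebius hB]
  have e1 : (A 1 0 : ℂ) * (((B 0 0 : ℂ) * z + B 0 1) / ((B 1 0 : ℂ) * z + B 1 1)) + A 1 1 =
      (((A * B) 1 0 : ℂ) * z + (A * B) 1 1) / ((B 1 0 : ℂ) * z + B 1 1) := by
    simp only [Matrix.mul_apply, Fin.sum_univ_two]
    push_cast
    rw [eq_div_iff hB0, add_mul, mul_assoc, div_mul_cancel₀ _ hB0]
    ring
  have e2 : (A 0 0 : ℂ) * (((B 0 0 : ℂ) * z + B 0 1) / ((B 1 0 : ℂ) * z + B 1 1)) + A 0 1 =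
      (((A * B) 0 0 : ℂ) * z + (A * B) 0 1) / ((B 1 0 : ℂ) * z + B 1 1) := by
    simp only [Matrix.mul_apply, Fin.sum_univ_two]
    push_cast
    rw [eq_div_iff hB0, add_mul, mul_assoc, div_mul_cancel₀ _ hB0]
    ring
  rw [e1, e2, div_div_div_cancel_right₀ hB0, Matrix.det_mul, Int.cast_mul, mul_pow]
  rw [← mul_assoc]
  congr 1
  rw [div_pow]
  field_simp

lemma intSlash_smul (m : ℕ) {n : ℤ} (hn : n ≠ 0) (A : Matrix (Fin 2) (Fin 2) ℤ) (f : ℍ → ℂ) :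
    intSlash m (n • A) f = intSlash m A f := by
  ext z
  have hn' : (n : ℂ) ≠ 0 := by exact_mod_cast hn
  rw [intSlash_apply, intSlash_apply]
  simp only [Matrix.smul_apply, smul_eq_mul, Matrix.det_smul, Fintype.card_fin]
  push_cast
  have e1 : (n : ℂ) * A 0 0 * z + n * A 0 1 = n * (A 0 0 * z + A 0 1) := by ring
  have e2 : (n : ℂ) * A 1 0 * z + n * A 1 1 = n * (A 1 0 * z + A 1 1) := by ring
  rw [e1, e2, mul_div_mul_left _ _ hn', mul_pow, mul_pow, ← pow_mul, mul_div_mul_left]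
  positivity

/-- Proportional integral matrices act in the same way. -/
lemma intSlash_congr (m : ℕ) {A B : Matrix (Fin 2) (Fin 2) ℤ} (r s : ℤ) (hr : r ≠ 0) (hs : s ≠ 0)
    (h : r • A = s • B) (f : ℍ → ℂ) : intSlash m A f = intSlash m B f := by
  rw [← intSlash_smul m hr, h, intSlash_smul m hs]

lemma intSlash_one (m : ℕ) (f : ℍ → ℂ) : intSlash m 1 f = f := by
  ext z
  rw [intSlash_apply]
  simp

/-- The adjugate acts as the inverse. -/
lemma intSlash_adjugate_eq (m : ℕ) {A : Matrix (Fin 2) (Fin 2) ℤ} (hA : 0 < A.det)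
    {f g : ℍ → ℂ} (h : intSlash m A f = g) : intSlash m A.adjugate g = f := by
  have hd : A.adjugate.det = A.det := by rw [Matrix.det_adjugate]; simp
  rw [← h, intSlash_intSlash m hA (hd ▸ hA), Matrix.mul_adjugate]
  rw [intSlash_smul m hA.ne', intSlash_one]

lemma intSlash_injective (m : ℕ) {A : Matrix (Fin 2) (Fin 2) ℤ} (hA : 0 < A.det) {f g : ℍ → ℂ}
    (h : intSlash m A f = intSlash m A g) : f = g := by
  rw [← intSlash_adjugate_eq m hA h, intSlash_adjugate_eq m hA rfl]

/-- Holomorphy of a function on the upper half-plane, as a condition on open sets of `ℂ`. -/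
def Holo (f : ℍ → ℂ) : Prop := DifferentiableOn ℂ (f ∘ ofComplex) {z | 0 < z.im}

lemma Holo.intSlash {f : ℍ → ℂ} (hf : Holo f) (m : ℕ) {A : Matrix (Fin 2) (Fin 2) ℤ}
    (hA : 0 < A.det) : Holo (intSlash m A f) := by
  have key : Set.EqOn (HeckeConverse.intSlash m A f ∘ ofComplex)
      (fun z => (A.det : ℂ) ^ m / ((A 1 0 : ℂ) * z + A 1 1) ^ (2 * m) *
    (f ∘ ofComplex) (((A 0 0 : ℂ) * z + A 0 1) / ((A 1 0 : ℂ) * z + A 1 1))) {z | 0 < z.im} := by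
    intro z hz
    simp only [Function.comp, intSlash_apply, ofComplex_apply_of_im_pos hz]
  refine DifferentiableOn.congr ?_ key
  have hne : ∀ z ∈ {z : ℂ | 0 < z.im}, (A 1 0 : ℂ) * z + A 1 1 ≠ 0 :=
    fun z hz => denom_ne_zero_of_det_pos hA hz
  refine DifferentiableOn.mul ?_ ?_
  · exact (by fun_prop : DifferentiableOn ℂ (fun z : ℂ => (A.det : ℂ) ^ m) _).div (by fun_prop)
      fun z hz => pow_ne_zero _ (hne z hz)
  · refine hf.comp (DifferentiableOn.div (by fun_prop) (by fun_prop) hne) ?_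
    exact fun z hz => im_moebius_pos hA hz

lemma Holo.add {f g : ℍ → ℂ} (hf : Holo f) (hg : Holo g) : Holo (f + g) :=
  DifferentiableOn.add hf hg

lemma Holo.sub {f g : ℍ → ℂ} (hf : Holo f) (hg : Holo g) : Holo (f - g) :=
  DifferentiableOn.sub hf hg

end

section

open UpperHalfPlane hiding I
open Complex

/-! ### Holomorphic functions invariant under an elliptic matrix of infinite order -/

lemma dvd_of_isOfFinOrder {t d : ℤ} (hd : d ≠ 0) {l : ℂ} {n : ℕ} (hn : 0 < n) (hl : l ^ n = 1)
    (h : l + l⁻¹ + 2 = (t : ℂ) / d) : d ∣ t := by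
  have hint : IsIntegral ℤ l := IsIntegral.of_pow hn (hl ▸ isIntegral_one)
  have hint' : IsIntegral ℤ l⁻¹ := IsIntegral.of_pow hn (by
    rw [inv_pow, hl, inv_one]
    exact isIntegral_one)
  have h2 : IsIntegral ℤ ((t : ℂ) / d) := by
    rw [← h]
    exact (hint.add hint').add (by simpa using isIntegral_algebraMap (R := ℤ) (A := ℂ) (x := 2))
  have h3 : IsIntegral ℤ ((t : ℚ) / d) := by
    rw [← isIntegral_algebraMap_iff (B := ℂ) (algebraMap ℚ ℂ).injective]
    simpa using h2
  obtain ⟨y, hy⟩ := IsIntegrallyClosed.isIntegral_iff.mp h3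
  refine ⟨y, ?_⟩
  have hd' : (d : ℚ) ≠ 0 := by exact_mod_cast hd
  rw [eq_div_iff hd'] at hy
  simp at hy
  have : y * d = t := by exact_mod_cast hy
  linarith

lemma exists_fixed_point {A : Matrix (Fin 2) (Fin 2) ℤ} (hell : A.trace ^ 2 < 4 * A.det) :
    ∃ z : ℂ, 0 < z.im ∧ (A 0 0 : ℂ) * z + A 0 1 = z * ((A 1 0 : ℂ) * z + A 1 1) := by
  rw [Matrix.trace_fin_two, Matrix.det_fin_two] at hell
  have hc : A 1 0 ≠ 0 := by
    intro hc
    rw [hc] at hell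
    nlinarith [sq_nonneg (A 0 0 - A 1 1)]
  have hc' : (A 1 0 : ℝ) ≠ 0 := by exact_mod_cast hc
  set Δ : ℝ := 4 * (A 0 0 * A 1 1 - A 0 1 * A 1 0) - (A 0 0 + A 1 1) ^ 2 with hΔ
  have hΔ0 : 0 < Δ := by
    rw [hΔ, sub_pos]; exact_mod_cast hell
  have hy : 0 < √Δ / (2 * |(A 1 0 : ℝ)|) := by positivity
  have hy2 : (√Δ / (2 * |(A 1 0 : ℝ)|)) ^ 2 = Δ / (4 * (A 1 0 : ℝ) ^ 2) := by
    rw [div_pow, mul_pow, sq_abs, Real.sq_sqrt hΔ0.le]; norm_num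
  set y : ℝ := √Δ / (2 * |(A 1 0 : ℝ)|)
  refine ⟨⟨(A 0 0 - A 1 1) / (2 * A 1 0), y⟩, hy, ?_⟩
  apply Complex.ext
  · simp
    have e : y * (A 1 0 * y) = A 1 0 * (Δ / (4 * (A 1 0 : ℝ) ^ 2)) := by
      linear_combination (A 1 0 : ℝ) * hy2
    rw [e, hΔ]
    field_simp
    ring
  · simp
    field_simp
    ring

/-- **Weil's lemma.** A holomorphic function which an elliptic matrix `A` multiplies by a sign
vanishes, unless the eigenvalue ratio `l` of `A` is a root of unity; as `l + l⁻¹ + 2` equals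
`tr(A)² / det(A)`, the latter is impossible when this rational number is not an integer. The proof
compares the leading coefficients of both sides at the fixed point of `A`. -/
theorem Holo.eq_zero_of_elliptic {m : ℕ} (hm : 0 < m) {A : Matrix (Fin 2) (Fin 2) ℤ}
    (hA : 0 < A.det) (hell : A.trace ^ 2 < 4 * A.det) (hndvd : ¬ A.det ∣ A.trace ^ 2)
    {h : ℍ → ℂ} (hh : Holo h) {ε : ℂ} (hε : ε ^ 2 = 1)
    (heq : HeckeConverse.intSlash m A h = ε • h) :
    h = 0 := by
  obtain ⟨z₀, hz₀, hfix⟩ := exists_fixed_point hell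
  have hopen : IsOpen {z : ℂ | 0 < z.im} := isOpen_lt continuous_const Complex.continuous_im
  have han : AnalyticOnNhd ℂ (h ∘ ofComplex) {z | 0 < z.im} := hh.analyticOnNhd hopen
  have hj := denom_ne_zero_of_det_pos hA hz₀
  have hD : (A.det : ℂ) ≠ 0 := by exact_mod_cast hA.ne'
  have hφ₀ : ((A 0 0 : ℂ) * z₀ + A 0 1) / ((A 1 0 : ℂ) * z₀ + A 1 1) = z₀ := by
    rw [hfix, mul_div_cancel_right₀ _ hj]
  have hφc : ContinuousAt (fun z : ℂ => ((A 0 0 : ℂ) * z + A 0 1) / ((A 1 0 : ℂ) * z + A 1 1)) z₀ :=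
    ContinuousAt.div (by fun_prop) (by fun_prop) hj
  by_cases hev : ∀ᶠ z in nhds z₀, (h ∘ ofComplex) z = 0
  · have hconv : IsPreconnected {z : ℂ | 0 < z.im} :=
      (convex_halfSpace_im_gt 0).isPreconnected
    have h0 := han.eqOn_zero_of_preconnected_of_eventuallyEq_zero hconv hz₀ hev
    ext z
    simpa using h0 z.2
  · exfalso
    obtain ⟨n, u, hu, hu0, hfac⟩ :=
      (han z₀ hz₀).exists_eventuallyEq_pow_smul_nonzero_iff.mpr hev
    have hφt : Filter.Tendsto
        (fun z : ℂ => ((A 0 0 : ℂ) * z + A 0 1) / ((A 1 0 : ℂ) * z + A 1 1))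
        (nhds z₀) (nhds z₀) := by
      simpa [ContinuousAt, hφ₀] using hφc
    have hev2 : ∀ᶠ z in nhdsWithin z₀ {z₀}ᶜ, ε * u z =
        (A.det : ℂ) ^ m / ((A 1 0 : ℂ) * z + A 1 1) ^ (2 * m) *
          ((A.det : ℂ) / (((A 1 0 : ℂ) * z + A 1 1) * ((A 1 0 : ℂ) * z₀ + A 1 1))) ^ n *
          u (((A 0 0 : ℂ) * z + A 0 1) / ((A 1 0 : ℂ) * z + A 1 1)) := by
      filter_upwards [nhdsWithin_le_nhds hfac, nhdsWithin_le_nhds (hφt.eventually hfac),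
        nhdsWithin_le_nhds (hopen.mem_nhds hz₀), self_mem_nhdsWithin] with z h1 h2 h3 h4
      have hz : z - z₀ ≠ 0 := sub_ne_zero.mpr h4
      have hjz := denom_ne_zero_of_det_pos hA h3
      have e := congrFun heq (ofComplex z)
      rw [intSlash_apply, Pi.smul_apply, smul_eq_mul, ofComplex_apply_of_im_pos h3] at e
      simp only [Function.comp, ofComplex_apply_of_im_pos h3, smul_eq_mul] at h1 h2 e
      rw [h1, h2] at e
      have hdiff : ((A 0 0 : ℂ) * z + A 0 1) / ((A 1 0 : ℂ) * z + A 1 1) - z₀ =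
          (z - z₀) * ((A.det : ℂ) / (((A 1 0 : ℂ) * z + A 1 1) * ((A 1 0 : ℂ) * z₀ + A 1 1))) := by
        nth_rewrite 1 [← hφ₀]
        rw [Matrix.det_fin_two]
        push_cast
        rw [div_sub_div _ _ hjz hj, ← mul_div_assoc]
        congr 1
        ring
      rw [hdiff, mul_pow] at e
      apply mul_left_cancel₀ (pow_ne_zero n hz)
      linear_combination -e
    have hlim1 : Filter.Tendsto (fun z => ε * u z) (nhdsWithin z₀ {z₀}ᶜ) (nhds (ε * u z₀)) :=
      (hu.continuousAt.tendsto.const_mul ε).mono_left nhdsWithin_le_nhds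
    have hcu : ContinuousAt
        (fun z => u (((A 0 0 : ℂ) * z + A 0 1) / ((A 1 0 : ℂ) * z + A 1 1))) z₀ :=
      ContinuousAt.comp (f := fun z : ℂ => ((A 0 0 : ℂ) * z + A 0 1) / ((A 1 0 : ℂ) * z + A 1 1))
        (by rw [hφ₀]; exact hu.continuousAt) hφc
    have hc2 : ContinuousAt (fun z => (A.det : ℂ) ^ m / ((A 1 0 : ℂ) * z + A 1 1) ^ (2 * m) *
          ((A.det : ℂ) / (((A 1 0 : ℂ) * z + A 1 1) * ((A 1 0 : ℂ) * z₀ + A 1 1))) ^ n *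
          u (((A 0 0 : ℂ) * z + A 0 1) / ((A 1 0 : ℂ) * z + A 1 1))) z₀ := by
      refine ContinuousAt.mul (ContinuousAt.mul ?_ (ContinuousAt.pow ?_ _)) hcu
      · exact ContinuousAt.div (by fun_prop) (by fun_prop) (pow_ne_zero _ hj)
      · exact ContinuousAt.div (by fun_prop) (by fun_prop) (mul_ne_zero hj hj)
    have hlim2 := (hc2.tendsto.mono_left (nhdsWithin_le_nhds (s := {z₀}ᶜ)))
    have e := tendsto_nhds_unique (hlim1.congr' hev2) hlim2
    rw [hφ₀] at e
    have e' : ε = ((A.det : ℂ) / ((A 1 0 : ℂ) * z₀ + A 1 1) ^ 2) ^ (m + n) := by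
      apply mul_right_cancel₀ hu0
      rw [e]
      congr 1
      rw [pow_add, div_pow, div_pow, div_pow, ← pow_mul, ← sq]
    refine hndvd (dvd_of_isOfFinOrder (n := (m + n) * 2) hA.ne' (by positivity)
      (l := (A.det : ℂ) / ((A 1 0 : ℂ) * z₀ + A 1 1) ^ 2) (by rw [pow_mul, ← e', hε]) ?_)
    have hchar : ((A 1 0 : ℂ) * z₀ + A 1 1) ^ 2 + A.det =
        A.trace * ((A 1 0 : ℂ) * z₀ + A 1 1) := by
      rw [Matrix.det_fin_two, Matrix.trace_fin_two]
      push_cast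
      linear_combination -(A 1 0 : ℂ) * hfix
    rw [Int.cast_pow]
    generalize (A 1 0 : ℂ) * z₀ + A 1 1 = j at hj hchar
    field_simp
    linear_combination (j ^ 2 + A.det + A.trace * j) * hchar

end

section

open CongruenceSubgroup

/-! ### Generators of `Γ₀(2)`, `Γ₀(5)` and `Γ₀(6)` -/

lemma mem_Gamma0_iff_dvd {N : ℕ} {γ : SL(2, ℤ)} : γ ∈ Gamma0 N ↔ (N : ℤ) ∣ γ 1 0 := by
  rw [Gamma0_mem, ZMod.intCast_zmod_eq_zero_iff_dvd]

/-- The lower triangular unipotent matrix with lower left entry `c`. -/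
def lowerUnip (c : ℤ) : SL(2, ℤ) := ⟨!![1, 0; c, 1], by simp⟩

/-- An elliptic element of order two of `Γ₀(5)` modulo `±1`. -/
def ell : SL(2, ℤ) := ⟨!![2, -1; 5, -2], by simp⟩

/-- The conjugate of `ell` by the Fricke matrix of level `5`. -/
def ell' : SL(2, ℤ) := ⟨!![-2, -1; 5, 2], by simp⟩

/-- A hyperbolic element of `Γ₀(6)`. -/
def hyp : SL(2, ℤ) := ⟨!![5, 2; 12, 5], by simp⟩

lemma mul_lower_left (γ η : SL(2, ℤ)) : (γ * η) 1 0 = γ 1 0 * η 0 0 + γ 1 1 * η 1 0 := by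
  simp [Matrix.mul_apply, Fin.sum_univ_two]

lemma mul_inv_lower_left (γ η : SL(2, ℤ)) :
    (γ * η⁻¹) 1 0 = γ 1 0 * η 1 1 - γ 1 1 * η 1 0 := by
  simp [Matrix.mul_apply, Fin.sum_univ_two, Matrix.SpecialLinearGroup.coe_inv,
    Matrix.adjugate_fin_two, sub_eq_add_neg]

lemma isUnit_of_lower_right_eq_zero {γ : SL(2, ℤ)} {n : ℤ} (h : γ 1 0 = n * γ 1 1) :
    IsUnit (γ 1 1) := by
  have hdet := γ.det_coe
  rw [Matrix.det_fin_two] at hdet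
  exact IsUnit.of_mul_eq_one (γ 0 0 - γ 0 1 * n) (by linear_combination hdet + γ 0 1 * h)

/-- Euclid's algorithm on bottom rows: a subgroup containing `-1` and `T` contains `Γ₀(N)` as soon
as its elements can decrease the lower left entry of every reduced matrix of `Γ₀(N)`. -/
lemma Gamma0_le_of_descent {N : ℕ} {H : Subgroup SL(2, ℤ)} (hneg : -1 ∈ H)
    (hT : ModularGroup.T ∈ H)
    (hdesc : ∀ γ ∈ Gamma0 N, γ 1 0 ≠ 0 → 2 * |γ 1 1| ≤ |γ 1 0| →
      ∃ η ∈ H, η ∈ Gamma0 N ∧ |(γ * η) 1 0| < |γ 1 0|) :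
    Gamma0 N ≤ H := by
  have key : ∀ n : ℕ, ∀ γ ∈ Gamma0 N, (γ 1 0).natAbs = n → γ ∈ H := by
    intro n
    induction n using Nat.strong_induction_on with
    | _ n ih =>
      intro γ hγ hn
      by_cases hc : γ 1 0 = 0
      · have hdet := γ.det_coe
        rw [Matrix.det_fin_two, hc, mul_zero, sub_zero] at hdet
        rcases Int.mul_eq_one_iff_eq_one_or_neg_one.mp hdet with ⟨h0, h1⟩ | ⟨h0, h1⟩
        · have : γ = ModularGroup.T ^ (γ 0 1) := by
            ext i j
            rw [ModularGroup.coe_T_zpow]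
            fin_cases i <;> fin_cases j <;> simp [h0, h1, hc]
          rw [this]
          exact H.zpow_mem hT _
        · have : γ = -1 * ModularGroup.T ^ (-γ 0 1) := by
            ext i j
            rw [neg_mul, one_mul, Matrix.SpecialLinearGroup.coe_neg, ModularGroup.coe_T_zpow]
            fin_cases i <;> fin_cases j <;> simp [h0, h1, hc]
          rw [this]
          exact H.mul_mem hneg (H.zpow_mem hT _)
      · obtain ⟨j, hj⟩ : ∃ j : ℤ, 2 * |γ 1 1 + γ 1 0 * j| ≤ |γ 1 0| := by
          refine ⟨-((2 * γ 1 1 + |γ 1 0|) / (2 * γ 1 0)), ?_⟩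
          have h1 := Int.emod_add_mul_ediv (2 * γ 1 1 + |γ 1 0|) (2 * γ 1 0)
          have h2 := Int.emod_nonneg (2 * γ 1 1 + |γ 1 0|) (b := 2 * γ 1 0) (by omega)
          have h3 := Int.emod_lt_abs (2 * γ 1 1 + |γ 1 0|) (b := 2 * γ 1 0) (by omega)
          rw [mul_assoc] at h1
          generalize hx : γ 1 0 * ((2 * γ 1 1 + |γ 1 0|) / (2 * γ 1 0))  = x at h1
          rw [mul_neg, hx]
          rw [abs_mul, abs_two] at h3
          rcases abs_cases (γ 1 0) with ⟨h4, h5⟩ | ⟨h4, h5⟩ <;>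
          rcases abs_cases (γ 1 1 + -x) with ⟨h6, h7⟩ | ⟨h6, h7⟩ <;> omega
        have e0 : (γ * ModularGroup.T ^ j) 1 0 = γ 1 0 := by
          rw [mul_lower_left]; simp [ModularGroup.coe_T_zpow]
        have e1 : (γ * ModularGroup.T ^ j) 1 1 = γ 1 1 + γ 1 0 * j := by
          simp [Matrix.mul_apply, Fin.sum_univ_two, ModularGroup.coe_T_zpow]; ring
        have hγT : γ * ModularGroup.T ^ j ∈ Gamma0 N := by
          rw [mem_Gamma0_iff_dvd, e0]; exact mem_Gamma0_iff_dvd.mp hγ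
        obtain ⟨η, hηH, hη, hlt⟩ := hdesc _ hγT (by rwa [e0]) (by rwa [e0, e1])
        rw [e0] at hlt
        have := ih _ (by subst hn; exact by zify; exact hlt) _ (mul_mem hγT hη) rfl
        rwa [H.mul_mem_cancel_right hηH, H.mul_mem_cancel_right (H.zpow_mem hT j)] at this
  exact fun γ hγ => key _ γ hγ rfl

lemma lower_right_ne_zero {N : ℕ} (hN : 2 ≤ N) {γ : SL(2, ℤ)} (hγ : γ ∈ Gamma0 N) :
    γ 1 1 ≠ 0 := by
  intro h
  have hdet := γ.det_coe
  rw [Matrix.det_fin_two, h, mul_zero, zero_sub] at hdet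
  obtain ⟨x, hx⟩ := mem_Gamma0_iff_dvd.mp hγ
  have : (N : ℤ) ∣ 1 := ⟨-γ 0 1 * x, by linear_combination -γ 0 1 * hx - hdet⟩
  have := Int.le_of_dvd one_pos this
  omega

lemma Gamma0_two_le {H : Subgroup SL(2, ℤ)} (hneg : -1 ∈ H) (hT : ModularGroup.T ∈ H)
    (hS : lowerUnip 2 ∈ H) : Gamma0 2 ≤ H := by
  refine Gamma0_le_of_descent hneg hT fun γ hγ hc hd => ?_
  have hd0 := lower_right_ne_zero le_rfl hγ
  have h1 : lowerUnip 2 ∈ Gamma0 2 := by rw [mem_Gamma0_iff_dvd]; simp [lowerUnip]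
  by_cases hs : 0 < γ 1 0 ↔ 0 < γ 1 1
  · refine ⟨_, inv_mem hS, inv_mem h1, ?_⟩
    rw [mul_inv_lower_left]
    simp [lowerUnip]
    grind
  · refine ⟨_, hS, h1, ?_⟩
    rw [mul_lower_left]
    simp [lowerUnip]
    grind

lemma Gamma0_five_le {H : Subgroup SL(2, ℤ)} (hneg : -1 ∈ H) (hT : ModularGroup.T ∈ H)
    (hS : lowerUnip 5 ∈ H) (he : ell ∈ H) (he' : ell' ∈ H) : Gamma0 5 ≤ H := by
  refine Gamma0_le_of_descent hneg hT fun γ hγ hc hd => ?_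
  have hd0 := lower_right_ne_zero (by norm_num) hγ
  have h1 : lowerUnip 5 ∈ Gamma0 5 := by rw [mem_Gamma0_iff_dvd]; simp [lowerUnip]
  have h2 : ell ∈ Gamma0 5 := by rw [mem_Gamma0_iff_dvd]; simp [ell]
  have h3 : ell' ∈ Gamma0 5 := by rw [mem_Gamma0_iff_dvd]; simp [ell']
  by_cases hs : 0 < γ 1 0 ↔ 0 < γ 1 1 <;> by_cases hlt : 3 * |γ 1 1| < |γ 1 0|
  · refine ⟨_, inv_mem hS, inv_mem h1, ?_⟩
    rw [mul_inv_lower_left]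
    simp [lowerUnip]
    grind
  · refine ⟨_, he', h3, ?_⟩
    rw [mul_lower_left]
    simp [ell']
    grind
  · refine ⟨_, hS, h1, ?_⟩
    rw [mul_lower_left]
    simp [lowerUnip]
    grind
  · refine ⟨_, he, h2, ?_⟩
    rw [mul_lower_left]
    simp [ell]
    grind

lemma Gamma0_six_le {H : Subgroup SL(2, ℤ)} (hneg : -1 ∈ H) (hT : ModularGroup.T ∈ H)
    (hS : lowerUnip 6 ∈ H) (hh : hyp ∈ H) : Gamma0 6 ≤ H := by
  refine Gamma0_le_of_descent hneg hT fun γ hγ hc hd => ?_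
  have hd0 := lower_right_ne_zero (by norm_num) hγ
  have h1 : lowerUnip 6 ∈ Gamma0 6 := by rw [mem_Gamma0_iff_dvd]; simp [lowerUnip]
  have h2 : hyp ∈ Gamma0 6 := by rw [mem_Gamma0_iff_dvd]; simp [hyp]
  obtain ⟨x, hx⟩ := mem_Gamma0_iff_dvd.mp hγ
  -- the values `±1/3` and `±1/2` of `d / c` are excluded, as `6 ∣ c` and `(c, d) = 1`
  have hn : ∀ n : ℤ, (n = 2 ∨ n = 3 ∨ n = -2 ∨ n = -3) → γ 1 0 ≠ n * γ 1 1 := by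
    intro n hn h
    rcases Int.isUnit_iff.mp (isUnit_of_lower_right_eq_zero h) with h' | h' <;>
      rw [h'] at h <;> push_cast at hx <;> omega
  have n1 := hn 2 (by simp)
  have n2 := hn 3 (by simp)
  have n3 := hn (-2) (by simp)
  have n4 := hn (-3) (by simp)
  by_cases hs : 0 < γ 1 0 ↔ 0 < γ 1 1 <;> by_cases hlt : 3 * |γ 1 1| < |γ 1 0|
  · refine ⟨_, inv_mem hS, inv_mem h1, ?_⟩
    rw [mul_inv_lower_left]
    simp [lowerUnip]
    grind
  · refine ⟨_, inv_mem hh, inv_mem h2, ?_⟩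
    rw [mul_inv_lower_left]
    simp [hyp]
    grind
  · refine ⟨_, hS, h1, ?_⟩
    rw [mul_lower_left]
    simp [lowerUnip]
    grind
  · refine ⟨_, hh, h2, ?_⟩
    rw [mul_lower_left]
    simp [hyp]
    grind

end

section

open UpperHalfPlane hiding I
open CongruenceSubgroup

/-! ### Level five and level six -/

/-- Composition of two actions, with the product of matrices known up to proportionality. -/
lemma intSlash_comp {m : ℕ} {A B : Matrix (Fin 2) (Fin 2) ℤ} (M : Matrix (Fin 2) (Fin 2) ℤ)
    (r s : ℤ) (f : ℍ → ℂ) (hA : 0 < A.det := by decide) (hB : 0 < B.det := by decide)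
    (hr : r ≠ 0 := by decide) (hs : s ≠ 0 := by decide)
    (h : r • M = s • (A * B) := by decide) :
    intSlash m B (intSlash m A f) = intSlash m M f := by
  rw [intSlash_intSlash m hA hB, intSlash_congr m r s hr hs h]

lemma intSlash_SL_mul (m : ℕ) (γ δ : SL(2, ℤ)) (f : ℍ → ℂ) :
    intSlash m (γ * δ : SL(2, ℤ)) f = intSlash m δ (intSlash m γ f) := by
  rw [intSlash_intSlash m (by simp) (by simp), Matrix.SpecialLinearGroup.coe_mul]

lemma intSlash_SL_neg_one (m : ℕ) (f : ℍ → ℂ) : intSlash m (-1 : SL(2, ℤ)) f = f := by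
  rw [intSlash_congr m (B := 1) 1 (-1) (by decide) (by decide) (by simp), intSlash_one]

lemma intSlash_SL_one (m : ℕ) (f : ℍ → ℂ) : intSlash m (1 : SL(2, ℤ)) f = f :=
  intSlash_one m f

/-- The elements of `Γ` under which `g` transforms by the function `χ`, multiplicative on `Γ`. -/
def semiInvariance (m : ℕ) (g : ℍ → ℂ) (Γ : Subgroup SL(2, ℤ)) (χ : SL(2, ℤ) → ℂ) (h1 : χ 1 = 1)
    (hmul : ∀ γ ∈ Γ, ∀ δ ∈ Γ, χ (γ * δ) = χ γ * χ δ) : Subgroup SL(2, ℤ) where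
  carrier := {γ | γ ∈ Γ ∧ intSlash m γ g = χ γ • g}
  one_mem' := ⟨Γ.one_mem, by rw [intSlash_SL_one, h1, one_smul]⟩
  mul_mem' := by
    rintro γ δ ⟨hγ, eγ⟩ ⟨hδ, eδ⟩
    exact ⟨mul_mem hγ hδ, by rw [intSlash_SL_mul, eγ, map_smul, eδ, smul_smul, hmul γ hγ δ hδ]⟩
  inv_mem' := by
    rintro γ ⟨hγ, eγ⟩
    refine ⟨inv_mem hγ, ?_⟩
    have e : χ γ⁻¹ * χ γ = 1 := by rw [← hmul _ (inv_mem hγ) _ hγ, inv_mul_cancel, h1]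
    have h := intSlash_SL_mul m γ γ⁻¹ g
    rw [mul_inv_cancel, intSlash_SL_one, eγ, map_smul] at h
    rw [← one_smul ℂ (intSlash m _ g), ← e, mul_smul, ← h]

lemma neg_one_zpow_congr {x y : ℤ} (h : (x : ZMod 2) = y) : (-1 : ℂ) ^ x = (-1 : ℂ) ^ y := by
  obtain ⟨k, hk⟩ := (ZMod.intCast_eq_intCast_iff_dvd_sub x y 2).mp h
  rw [show y = x + 2 * k by push_cast at hk; linarith, zpow_add₀ (by norm_num), zpow_mul]
  norm_num

/-- The sign of the permutation of the three points of `ℙ¹(𝔽₂)` induced by an integral matrix of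
determinant one. -/
noncomputable def signMod2 (γ : SL(2, ℤ)) : ℂ :=
  (-1) ^ (γ 0 0 * γ 0 1 + γ 0 1 * γ 1 0 + γ 1 0 * γ 1 1)

lemma det_mod_two (γ : SL(2, ℤ)) :
    (γ 0 0 : ZMod 2) * (γ 1 1 : ZMod 2) + (γ 0 1 : ZMod 2) * (γ 1 0 : ZMod 2) = 1 := by
  have h := γ.det_coe
  rw [Matrix.det_fin_two] at h
  have h' := congrArg (Int.cast : ℤ → ZMod 2) h
  push_cast at h'
  rw [← h', sub_eq_add_neg, ZMod.neg_eq_self_mod_two]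

lemma signMod2_mul (γ δ : SL(2, ℤ)) : signMod2 (γ * δ) = signMod2 γ * signMod2 δ := by
  rw [signMod2, signMod2, signMod2, ← zpow_add₀ (by norm_num)]
  apply neg_one_zpow_congr
  have h1 := det_mod_two γ
  have h2 := det_mod_two δ
  simp only [Matrix.SpecialLinearGroup.coe_mul, Matrix.mul_apply, Fin.sum_univ_two]
  push_cast
  generalize (γ 0 0 : ZMod 2) = a at *
  generalize (γ 0 1 : ZMod 2) = b at *
  generalize (γ 1 0 : ZMod 2) = c at *
  generalize (γ 1 1 : ZMod 2) = d at *
  generalize (δ 0 0 : ZMod 2) = a' at *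
  generalize (δ 0 1 : ZMod 2) = b' at *
  generalize (δ 1 0 : ZMod 2) = c' at *
  generalize (δ 1 1 : ZMod 2) = d' at *
  revert a b c d a' b' c' d'
  decide

/-- The quadratic character `γ ↦ (-1) ^ (b + c / 2)` of `Γ₀(2)`. -/
noncomputable def signGamma0Two (γ : SL(2, ℤ)) : ℂ := (-1) ^ (γ 0 1 + γ 1 0 / 2)

lemma signGamma0Two_mul {γ δ : SL(2, ℤ)} (hγ : (2 : ℤ) ∣ γ 1 0) (hδ : (2 : ℤ) ∣ δ 1 0) :
    signGamma0Two (γ * δ) = signGamma0Two γ * signGamma0Two δ := by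
  rw [signGamma0Two, signGamma0Two, signGamma0Two, ← zpow_add₀ (by norm_num)]
  apply neg_one_zpow_congr
  have h1 := det_mod_two γ
  have h2 := det_mod_two δ
  simp only [Matrix.SpecialLinearGroup.coe_mul, Matrix.mul_apply, Fin.sum_univ_two]
  obtain ⟨x, hx⟩ := hγ
  obtain ⟨y, hy⟩ := hδ
  rw [hx] at h1 ⊢
  rw [hy] at h2 ⊢
  rw [show 2 * x * δ 0 0 + γ 1 1 * (2 * y) = 2 * (x * δ 0 0 + γ 1 1 * y) by ring]
  simp only [Int.mul_ediv_cancel_left _ (two_ne_zero : (2 : ℤ) ≠ 0)]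
  push_cast at h1 h2 ⊢
  generalize (γ 0 0 : ZMod 2) = a at *
  generalize (γ 0 1 : ZMod 2) = b at *
  generalize (γ 1 1 : ZMod 2) = d at *
  generalize (δ 0 0 : ZMod 2) = a' at *
  generalize (δ 0 1 : ZMod 2) = b' at *
  generalize (δ 1 1 : ZMod 2) = d' at *
  generalize (x : ZMod 2) = c at *
  generalize (y : ZMod 2) = c' at *
  revert a b c d a' b' c' d'
  decide

lemma intSlash_T_inv {m : ℕ} {g : ℍ → ℂ} (hT : intSlash m !![1, 1; 0, 1] g = -g) :
    intSlash m !![1, -1; 0, 1] g = -g := by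
  have h := intSlash_adjugate_eq m (A := !![1, 1; 0, 1]) (by decide) hT
  rw [map_neg, Matrix.adjugate_fin_two_of, neg_zero] at h
  rw [eq_neg_iff_add_eq_zero, ← neg_eq_iff_add_eq_zero, h]

/-- The Hecke relation at `3` forces the elliptic matrix `ell` of `Γ₀(5)` to act by `-1`: the defect
is multiplied by a sign under an elliptic matrix of infinite order. -/
lemma intSlash_ell {m : ℕ} {g : ℍ → ℂ} (hm : 0 < m) (hg : Holo g)
    (hT : intSlash m !![1, 1; 0, 1] g = -g)
    (hW : intSlash m !![0, -1; 5, 0] g = g) {l : ℂ}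
    (hH : intSlash m !![3, 0; 0, 1] g + intSlash m !![1, 0; 0, 3] g +
      intSlash m !![1, 2; 0, 3] g + intSlash m !![1, -2; 0, 3] g = l • g) :
    intSlash m !![2, -1; 5, -2] g = -g := by
  have hT' := intSlash_T_inv hT
  have hTWT : intSlash m !![5, 4; 5, 5] g = g := by
    rw [← intSlash_comp (A := !![1, 1; 0, 1]) (B := !![0, -1; 5, 5]) _ 1 1, hT,
      ← intSlash_comp (A := !![0, -1; 5, 0]) (B := !![1, 1; 0, 1]) _ 1 1, map_neg, hW,
      map_neg, hT, neg_neg]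
  have hTWT' : intSlash m !![-5, 4; 5, -5] g = g := by
    rw [← intSlash_comp (A := !![1, -1; 0, 1]) (B := !![0, -1; 5, -5]) _ 1 1, hT',
      ← intSlash_comp (A := !![0, -1; 5, 0]) (B := !![1, -1; 0, 1]) _ 1 1, map_neg, hW,
      map_neg, hT', neg_neg]
  set h := intSlash m !![2, -1; 5, -2] g + g with hh
  have he' : intSlash m !![-2, -1; 5, 2] g + g = intSlash m !![0, -1; 5, 0] h := by
    rw [← intSlash_comp (A := !![0, -1; 5, 0]) (B := !![-5, -2; -10, -5]) _ (-5) 1, hW,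
      ← intSlash_comp (A := !![2, -1; 5, -2]) (B := !![0, -1; 5, 0]) _ 1 1, hh, map_add, hW]
  have e1 : intSlash m !![0, -1; 5, 0] (intSlash m !![3, 0; 0, 1] g) =
      intSlash m !![1, 0; 0, 3] g := by
    rw [intSlash_comp !![0, -3; 5, 0] 1 1,
      ← intSlash_comp (A := !![0, -1; 5, 0]) (B := !![1, 0; 0, 3]) _ 1 1, hW]
  have e2 : intSlash m !![0, -1; 5, 0] (intSlash m !![1, 0; 0, 3] g) =
      intSlash m !![3, 0; 0, 1] g := by
    rw [intSlash_comp !![0, -1; 15, 0] 1 1,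
      ← intSlash_comp (A := !![0, -1; 5, 0]) (B := !![3, 0; 0, 1]) _ 1 1, hW]
  have e3 : intSlash m !![0, -1; 5, 0] (intSlash m !![1, 2; 0, 3] g) =
      intSlash m !![1, -1; 0, 3] (intSlash m !![-2, -1; 5, 2] g) := by
    rw [intSlash_comp !![10, -1; 15, 0] 1 1,
      ← intSlash_comp (A := !![5, 4; 5, 5]) (B := !![-2, -1; 5, 1]) _ 1 1, hTWT,
      intSlash_comp (A := !![-2, -1; 5, 2]) !![-2, -1; 5, 1] 1 1]
  have e4 : intSlash m !![0, -1; 5, 0] (intSlash m !![1, -2; 0, 3] g) =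
      intSlash m !![1, 1; 0, 3] (intSlash m !![2, -1; 5, -2] g) := by
    rw [intSlash_comp !![-10, -1; 15, 0] 1 1,
      ← intSlash_comp (A := !![-5, 4; 5, -5]) (B := !![2, -1; 5, -1]) _ (-1) 1, hTWT',
      intSlash_comp (A := !![2, -1; 5, -2]) !![2, -1; 5, -1] 1 1]
  have e5 : intSlash m !![1, 2; 0, 3] g = -intSlash m !![1, -1; 0, 3] g := by
    rw [← intSlash_comp (A := !![1, 1; 0, 1]) (B := !![1, -1; 0, 3]) _ 1 1, hT, map_neg]
  have e6 : intSlash m !![1, -2; 0, 3] g = -intSlash m !![1, 1; 0, 3] g := by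
    rw [← intSlash_comp (A := !![1, -1; 0, 1]) (B := !![1, 1; 0, 3]) _ 1 1, hT', map_neg]
  -- the difference of the Hecke relation and its image under the Fricke matrix
  have key : intSlash m !![1, -1; 0, 3] (intSlash m !![0, -1; 5, 0] h) =
      -intSlash m !![1, 1; 0, 3] h := by
    have hH' := congrArg (intSlash m !![0, -1; 5, 0]) hH
    rw [map_add, map_add, map_add, e1, e2, e3, e4, map_smul, hW, ← hH, e5, e6] at hH'
    rw [← he', hh, map_add, map_add, eq_neg_iff_add_eq_zero, ← sub_eq_zero.mpr hH']
    abel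
  have hfin : intSlash m !![0, -3; 15, -10] h = (-1 : ℂ) • h := by
    have := congrArg (intSlash m !![3, -1; 0, 1]) key
    rw [map_neg, intSlash_comp (A := !![1, 1; 0, 3]) 1 3 1, intSlash_one,
      intSlash_comp (A := !![1, -1; 0, 3]) !![3, -2; 0, 3] 1 1,
      intSlash_comp (A := !![0, -1; 5, 0]) !![0, -3; 15, -10] 1 1] at this
    rw [this, neg_one_smul]
  have h0 : h = 0 := Holo.eq_zero_of_elliptic hm (by decide) (by decide) (by decide)
    ((hg.intSlash m (by decide)).add hg) (by norm_num) hfin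
  exact eq_neg_of_add_eq_zero_left h0

/-- A form of level five transforms by a character which is trivial on the matrices that are
diagonal modulo `2`. The coset representatives of the Hecke operator at `3` are taken with even
entries above the diagonal. -/
theorem intSlash_eq_of_level_five {m : ℕ} {g : ℍ → ℂ} (hm : 0 < m) (hg : Holo g)
    (hT : intSlash m !![1, 1; 0, 1] g = -g)
    (hW : intSlash m !![0, -1; 5, 0] g = g) {l : ℂ}
    (hH : intSlash m !![3, 0; 0, 1] g + intSlash m !![1, 0; 0, 3] g +
      intSlash m !![1, 2; 0, 3] g + intSlash m !![1, -2; 0, 3] g = l • g) :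
    ∀ γ ∈ Gamma0 5, intSlash m γ g = signMod2 γ • g := by
  have hT' := intSlash_T_inv hT
  have hS : intSlash m !![1, 0; 5, 1] g = -g := by
    rw [← intSlash_comp (A := !![0, -1; 5, 0]) (B := !![-5, -1; 5, 0]) _ (-5) 1,
      hW, ← intSlash_comp (A := !![1, -1; 0, 1]) (B := !![0, -1; 5, 0]) _ 1 1, hT', map_neg, hW]
  have he := intSlash_ell hm hg hT hW hH
  have he' : intSlash m !![-2, -1; 5, 2] g = -g := by
    rw [← intSlash_comp (A := !![0, -1; 5, 0]) (B := !![-5, -2; -10, -5]) _ (-5) 1, hW,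
      ← intSlash_comp (A := !![2, -1; 5, -2]) (B := !![0, -1; 5, 0]) _ 1 1, he, map_neg, hW]
  have hle := Gamma0_five_le (H := semiInvariance m g ⊤ signMod2 (by simp [signMod2])
    (fun γ _ δ _ => signMod2_mul γ δ))
    ⟨trivial, by rw [intSlash_SL_neg_one]; simp [signMod2]⟩
    ⟨trivial, by
      rw [show signMod2 ModularGroup.T = -1 by norm_num [signMod2, ModularGroup.T], neg_one_smul]
      exact hT⟩
    ⟨trivial, by
      rw [show signMod2 (lowerUnip 5) = -1 by norm_num [signMod2, lowerUnip, Odd.neg_one_zpow],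
        neg_one_smul]
      exact hS⟩
    ⟨trivial, by
      rw [show signMod2 ell = -1 by norm_num [signMod2, ell], neg_one_smul]
      exact he⟩
    ⟨trivial, by
      rw [show signMod2 ell' = -1 by norm_num [signMod2, ell'], neg_one_smul]
      exact he'⟩
  exact fun γ hγ => (hle hγ).2

/-- The Hecke relation at `5` forces the hyperbolic generator of `Γ₀(6)` to fix `g`: the defect is
fixed by an elliptic matrix of infinite order. -/
lemma intSlash_hyp {m : ℕ} {g : ℍ → ℂ} (hm : 0 < m) (hg : Holo g)
    (hT : intSlash m !![1, 1; 0, 1] g = -g)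
    (hW : intSlash m !![0, -1; 6, 0] g = g) {l : ℂ}
    (hH : intSlash m !![5, 0; 0, 1] g + intSlash m !![1, 0; 0, 5] g +
      intSlash m !![1, 2; 0, 5] g + intSlash m !![1, -2; 0, 5] g +
      intSlash m !![1, 4; 0, 5] g + intSlash m !![1, -4; 0, 5] g = l • g) :
    intSlash m !![5, -2; -12, 5] g = g := by
  have hT' := intSlash_T_inv hT
  have hTWT : intSlash m !![6, 5; 6, 6] g = g := by
    rw [← intSlash_comp (A := !![1, 1; 0, 1]) (B := !![0, -1; 6, 6]) _ 1 1, hT,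
      ← intSlash_comp (A := !![0, -1; 6, 0]) (B := !![1, 1; 0, 1]) _ 1 1, map_neg, hW,
      map_neg, hT, neg_neg]
  have hTWT' : intSlash m !![-6, 5; 6, -6] g = g := by
    rw [← intSlash_comp (A := !![1, -1; 0, 1]) (B := !![0, -1; 6, -6]) _ 1 1, hT',
      ← intSlash_comp (A := !![0, -1; 6, 0]) (B := !![1, -1; 0, 1]) _ 1 1, map_neg, hW,
      map_neg, hT', neg_neg]
  have hQ : intSlash m !![24, 19; 30, 24] g = g := by
    rw [← intSlash_comp (A := !![6, 5; 6, 6]) (B := !![-6, -6; 36, 30]) _ 6 1, hTWT,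
      ← intSlash_comp (A := !![0, -1; 6, 0]) (B := !![6, 5; 6, 6]) _ 1 1, hW, hTWT]
  have hQ' : intSlash m !![-24, 19; 30, -24] g = g := by
    rw [← intSlash_comp (A := !![-6, 5; 6, -6]) (B := !![-6, 6; -36, 30]) _ 6 1, hTWT',
      ← intSlash_comp (A := !![0, -1; 6, 0]) (B := !![-6, 5; 6, -6]) _ 1 1, hW, hTWT']
  set h := intSlash m !![5, -2; -12, 5] g - g with hh
  have hneg : intSlash m !![5, 2; 12, 5] g - g = -intSlash m !![5, 2; 12, 5] h := by
    rw [hh, map_sub, intSlash_comp (A := !![5, -2; -12, 5]) 1 1 1, intSlash_one, neg_sub]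
  have e1 : intSlash m !![0, -1; 6, 0] (intSlash m !![5, 0; 0, 1] g) =
      intSlash m !![1, 0; 0, 5] g := by
    rw [intSlash_comp !![0, -5; 6, 0] 1 1,
      ← intSlash_comp (A := !![0, -1; 6, 0]) (B := !![1, 0; 0, 5]) _ 1 1, hW]
  have e2 : intSlash m !![0, -1; 6, 0] (intSlash m !![1, 0; 0, 5] g) =
      intSlash m !![5, 0; 0, 1] g := by
    rw [intSlash_comp !![0, -1; 30, 0] 1 1,
      ← intSlash_comp (A := !![0, -1; 6, 0]) (B := !![5, 0; 0, 1]) _ 1 1, hW]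
  have e3 : intSlash m !![0, -1; 6, 0] (intSlash m !![1, 2; 0, 5] g) =
      intSlash m !![1, 2; 0, 5] (intSlash m !![5, -2; -12, 5] g) := by
    rw [intSlash_comp !![12, -1; 30, 0] 1 1,
      ← intSlash_comp (A := !![0, -1; 6, 0]) (B := !![5, 0; -12, 1]) _ 1 1, hW,
      intSlash_comp (A := !![5, -2; -12, 5]) !![5, 0; -12, 1] 1 1]
  have e4 : intSlash m !![0, -1; 6, 0] (intSlash m !![1, -2; 0, 5] g) =
      intSlash m !![1, -2; 0, 5] (intSlash m !![5, 2; 12, 5] g) := by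
    rw [intSlash_comp !![-12, -1; 30, 0] 1 1,
      ← intSlash_comp (A := !![0, -1; 6, 0]) (B := !![5, 0; 12, 1]) _ 1 1, hW,
      intSlash_comp (A := !![5, 2; 12, 5]) !![5, 0; 12, 1] 1 1]
  have e5 : intSlash m !![0, -1; 6, 0] (intSlash m !![1, 4; 0, 5] g) =
      intSlash m !![1, -4; 0, 5] g := by
    rw [intSlash_comp !![24, -1; 30, 0] 1 1,
      ← intSlash_comp (A := !![24, 19; 30, 24]) (B := !![1, -4; 0, 5]) _ 1 1, hQ]
  have e6 : intSlash m !![0, -1; 6, 0] (intSlash m !![1, -4; 0, 5] g) =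
      intSlash m !![1, 4; 0, 5] g := by
    rw [intSlash_comp !![-24, -1; 30, 0] 1 1,
      ← intSlash_comp (A := !![-24, 19; 30, -24]) (B := !![1, 4; 0, 5]) _ 1 1, hQ']
  -- the difference of the Hecke relation and its image under the Fricke matrix
  have key : intSlash m !![1, -2; 0, 5] (intSlash m !![5, 2; 12, 5] h) =
      intSlash m !![1, 2; 0, 5] h := by
    have hH' := congrArg (intSlash m !![0, -1; 6, 0]) hH
    rw [map_add, map_add, map_add, map_add, map_add, e1, e2, e3, e4, e5, e6, map_smul, hW,
      ← hH] at hH'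
    rw [← neg_eq_iff_eq_neg.mpr hneg, map_neg, hh, map_sub, map_sub, ← sub_eq_zero,
      ← sub_eq_zero.mpr hH'.symm]
    abel
  have hfin : intSlash m !![25, -10; 60, -23] h = (1 : ℂ) • h := by
    have := congrArg (intSlash m !![5, -2; 0, 1]) key
    rw [intSlash_comp (A := !![1, 2; 0, 5]) 1 5 1, intSlash_one,
      intSlash_comp (A := !![1, -2; 0, 5]) !![5, -4; 0, 5] 1 1,
      intSlash_comp (A := !![5, 2; 12, 5]) !![25, -10; 60, -23] 1 1] at this
    rw [this, one_smul]
  have h0 : h = 0 := Holo.eq_zero_of_elliptic hm (by decide) (by decide) (by decide)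
    ((hg.intSlash m (by decide)).sub hg) (by norm_num) hfin
  exact sub_eq_zero.mp h0

/-- A form of level six transforms by a character which is trivial on the matrices with upper right
entry even and lower left entry divisible by `4`. The coset representatives of the Hecke operator at
`5` are taken with even entries above the diagonal. -/
theorem intSlash_eq_of_level_six {m : ℕ} {g : ℍ → ℂ} (hm : 0 < m) (hg : Holo g)
    (hT : intSlash m !![1, 1; 0, 1] g = -g)
    (hW : intSlash m !![0, -1; 6, 0] g = g) {l : ℂ}
    (hH : intSlash m !![5, 0; 0, 1] g + intSlash m !![1, 0; 0, 5] g +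
      intSlash m !![1, 2; 0, 5] g + intSlash m !![1, -2; 0, 5] g +
      intSlash m !![1, 4; 0, 5] g + intSlash m !![1, -4; 0, 5] g = l • g) :
    ∀ γ ∈ Gamma0 6, intSlash m γ g = signGamma0Two γ • g := by
  have hT' := intSlash_T_inv hT
  have hS : intSlash m !![1, 0; 6, 1] g = -g := by
    rw [← intSlash_comp (A := !![0, -1; 6, 0]) (B := !![-6, -1; 6, 0]) _ (-6) 1,
      hW, ← intSlash_comp (A := !![1, -1; 0, 1]) (B := !![0, -1; 6, 0]) _ 1 1, hT', map_neg, hW]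
  have hh : intSlash m !![5, 2; 12, 5] g = g := by
    have := intSlash_adjugate_eq m (by decide) (intSlash_hyp hm hg hT hW hH)
    rwa [Matrix.adjugate_fin_two_of, neg_neg, neg_neg] at this
  have hle := Gamma0_six_le (H := semiInvariance m g (Gamma0 2) signGamma0Two
    (by simp [signGamma0Two]) (fun γ hγ δ hδ =>
      signGamma0Two_mul (mem_Gamma0_iff_dvd.mp hγ) (mem_Gamma0_iff_dvd.mp hδ)))
    ⟨by rw [mem_Gamma0_iff_dvd]; simp, by rw [intSlash_SL_neg_one]; simp [signGamma0Two]⟩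
    ⟨by rw [mem_Gamma0_iff_dvd]; simp [ModularGroup.T], by
      rw [show signGamma0Two ModularGroup.T = -1 by norm_num [signGamma0Two, ModularGroup.T],
        neg_one_smul]
      exact hT⟩
    ⟨by rw [mem_Gamma0_iff_dvd]; simp [lowerUnip], by
      rw [show signGamma0Two (lowerUnip 6) = -1 by norm_num [signGamma0Two, lowerUnip],
        neg_one_smul]
      exact hS⟩
    ⟨by rw [mem_Gamma0_iff_dvd]; simp [hyp], by
      rw [show signGamma0Two hyp = 1 by norm_num [signGamma0Two, hyp], one_smul]
      exact hh⟩
  exact fun γ hγ => (hle hγ).2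

end

section

open UpperHalfPlane hiding I
open CongruenceSubgroup

/-! ### Level two and the projective line over `𝔽₃` -/

/-- Four functions indexed by the points of `ℙ¹(𝔽₃)`, given in terms of row vectors, with
differences spanning the space generated by `g`, `u` and `w`, for a form `g` of level two with
`g + g ∣ T + g ∣ T² = 0`: here `u = g ∣ T` and `w = u ∣ W`. The value at `0` is irrelevant. -/
def pointFamily (g u w : ℍ → ℂ) (v : Fin 2 → ZMod 3) : ℍ → ℂ :=
  if v 0 = 0 then -w else if v 1 = 0 then -u else if v 0 = v 1 then g else 0

/-- The matrix modulo `3` of an element of `SL(2, ℤ)`. -/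
abbrev modThree (γ : SL(2, ℤ)) : Matrix (Fin 2) (Fin 2) (ZMod 3) :=
  (γ : Matrix (Fin 2) (Fin 2) ℤ).map (Int.cast : ℤ → ZMod 3)

lemma modThree_mul (γ δ : SL(2, ℤ)) : modThree (γ * δ) = modThree γ * modThree δ := by
  rw [modThree, Matrix.SpecialLinearGroup.coe_mul]
  exact Matrix.map_mul (f := Int.castRingHom (ZMod 3))

lemma modThree_one : modThree 1 = 1 := by simp [modThree]

lemma vecMul_modThree_ne_zero (γ : SL(2, ℤ)) {v : Fin 2 → ZMod 3} (hv : v ≠ 0) :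
    Matrix.vecMul v (modThree γ) ≠ 0 := by
  intro h
  apply hv
  rw [← Matrix.vecMul_one v, ← modThree_one, ← mul_inv_cancel γ, modThree_mul,
    ← Matrix.vecMul_vecMul, h, Matrix.zero_vecMul]

/-- The elements of `SL(2, ℤ)` which permute the functions `F v`, up to a common translation, as
they permute the row vectors `v` modulo `3`. -/
def permuting (m : ℕ) (F : (Fin 2 → ZMod 3) → ℍ → ℂ) : Subgroup SL(2, ℤ) where
  carrier := {γ | ∃ r, ∀ v, v ≠ 0 → intSlash m γ (F v) = F (Matrix.vecMul v (modThree γ)) + r}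
  one_mem' := ⟨0, fun v _ => by
    rw [intSlash_SL_one, modThree_one, Matrix.vecMul_one, add_zero]⟩
  mul_mem' := by
    rintro γ δ ⟨r, hr⟩ ⟨r', hr'⟩
    refine ⟨r' + intSlash m δ r, fun v hv => ?_⟩
    rw [intSlash_SL_mul, hr v hv, map_add, hr' _ (vecMul_modThree_ne_zero γ hv), modThree_mul,
      Matrix.vecMul_vecMul, add_assoc]
  inv_mem' := by
    rintro γ ⟨r, hr⟩
    refine ⟨-intSlash m (γ⁻¹ : SL(2, ℤ)) r, fun v hv => ?_⟩
    have h := congrArg (intSlash m (γ⁻¹ : SL(2, ℤ))) (hr _ (vecMul_modThree_ne_zero γ⁻¹ hv))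
    rw [← intSlash_SL_mul, mul_inv_cancel, intSlash_SL_one, Matrix.vecMul_vecMul, ← modThree_mul,
      inv_mul_cancel, modThree_one, Matrix.vecMul_one, map_add] at h
    rw [h]
    abel

/-- The hypothesis `hA` at an Atkin–Lehner matrix makes the space spanned by `g`, `g ∣ T` and
`g ∣ T W₂` stable under `Γ₀(2)`. -/
theorem intSlash_eq_of_level_two {m : ℕ} {g : ℍ → ℂ}
    (hT : g + intSlash m !![1, 1; 0, 1] g + intSlash m !![1, 2; 0, 1] g = 0)
    (hT3 : intSlash m !![1, 3; 0, 1] g = g)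
    (hW : intSlash m !![0, -1; 2, 0] g = g)
    (hA : intSlash m !![3, -5; 2, -3] g = -g) :
    ∀ γ ∈ Gamma0 2, (3 : ℤ) ∣ γ 0 1 → (3 : ℤ) ∣ γ 1 0 → intSlash m γ g = g := by
  set u := intSlash m !![1, 1; 0, 1] g with hu
  set w := intSlash m !![0, -1; 2, 0] u with hw
  have hTu : intSlash m !![1, 1; 0, 1] u = -g - u := by
    rw [hu, intSlash_comp !![1, 2; 0, 1] 1 1, ← hu, eq_sub_iff_add_eq, eq_neg_iff_add_eq_zero, ← hT]
    abel
  have hWw : intSlash m !![0, -1; 2, 0] w = u := by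
    rw [hw, intSlash_comp 1 (-2) 1, intSlash_one]
  have hTw : intSlash m !![1, 1; 0, 1] w = w - u := by
    have h2 : intSlash m !![1, -1; 0, 1] (intSlash m !![0, -1; 2, 0] (intSlash m !![1, 1; 0, 1]
      (intSlash m !![0, -1; 2, 0] (intSlash m !![1, 1; 0, 1] u)))) = -g := by
      rw [← hA, hu, intSlash_comp !![0, -1; 2, -2] 1 1, intSlash_comp !![2, -3; 2, -2] 1 1,
        intSlash_comp !![-2, 2; 4, -6] 1 1, intSlash_comp !![2, -4; 4, -6] 1 1,
        intSlash_comp !![3, -5; 2, -3] 2 1]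
    have h3 := congrArg (intSlash m !![1, 1; 0, 1]) h2
    rw [intSlash_comp (A := !![1, -1; 0, 1]) 1 1 1, intSlash_one, map_neg, ← hu] at h3
    have h4 := congrArg (intSlash m !![0, -1; 2, 0]) h3
    rw [intSlash_comp (A := !![0, -1; 2, 0]) 1 (-2) 1, intSlash_one, map_neg, ← hw, hTu, map_sub,
      map_neg, hW, ← hw, map_sub, map_neg, ← hu] at h4
    have h5 : u + intSlash m !![1, 1; 0, 1] w = w := by
      rw [← neg_inj, neg_add, ← sub_eq_add_neg, h4]
    exact eq_sub_of_add_eq' h5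
  have hT'g : intSlash m !![1, -1; 0, 1] g = -g - u := by
    rw [← hTu, hu, intSlash_comp !![1, 2; 0, 1] 1 1]
    nth_rewrite 1 [← hT3]
    rw [intSlash_comp !![1, 2; 0, 1] 1 1]
  have hT'u : intSlash m !![1, -1; 0, 1] u = g := by
    rw [hu, intSlash_comp 1 1 1, intSlash_one]
  have hT'w : intSlash m !![1, -1; 0, 1] w = w + g := by
    rw [← sub_eq_iff_eq_add, ← hT'u, ← map_sub, ← hTw, intSlash_comp 1 1 1, intSlash_one]
  have hS : ∀ f, intSlash m !![1, 0; 2, 1] f = intSlash m !![0, -1; 2, 0]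
      (intSlash m !![1, -1; 0, 1] (intSlash m !![0, -1; 2, 0] f)) := by
    intro f
    rw [intSlash_comp !![-2, -1; 2, 0] 1 1, intSlash_comp !![1, 0; 2, 1] (-2) 1]
  have hSg : intSlash m !![1, 0; 2, 1] g = -g - w := by
    rw [hS, hW, hT'g, map_sub, map_neg, hW, ← hw]
  have hSu : intSlash m !![1, 0; 2, 1] u = u + g := by
    rw [hS, ← hw, hT'w, map_add, hWw, hW]
  have hSw : intSlash m !![1, 0; 2, 1] w = g := by
    rw [hS, hWw, hT'u, hW]
  have hcases : ∀ x : ZMod 3, x = 0 ∨ x = 1 ∨ x = 2 := by decide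
  have d0 : (2 : ZMod 3) ≠ 0 := by decide
  have d1 : (1 : ZMod 3) ≠ 2 := by decide
  have d2 : (2 : ZMod 3) ≠ 1 := by decide
  have d3 : (1 : ZMod 3) + 1 = 2 := by decide
  have d4 : (1 : ZMod 3) + 2 = 0 := by decide
  have d5 : (2 : ZMod 3) + 1 = 0 := by decide
  have d6 : (2 : ZMod 3) + 2 = 1 := by decide
  have d7 : (2 : ZMod 3) * 2 = 1 := by decide
  have hle := Gamma0_two_le (H := permuting m (pointFamily g u w))
    ⟨0, fun v _ => by
      rw [intSlash_SL_neg_one, add_zero, pointFamily, pointFamily]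
      have e : ∀ i, Matrix.vecMul v (modThree (-1)) i = -v i := by
        intro i
        fin_cases i <;> simp [modThree, Matrix.vecMul, dotProduct, Fin.sum_univ_two]
      simp [e]⟩
    ⟨u, fun v hv => by
      have hv' : ¬ (v 0 = 0 ∧ v 1 = 0) := fun h => hv (by ext i; fin_cases i <;> simp [h])
      have e0 : Matrix.vecMul v (modThree ModularGroup.T) 0 = v 0 := by
        simp [modThree, Matrix.vecMul, dotProduct, Fin.sum_univ_two, ModularGroup.T]
      have e1 : Matrix.vecMul v (modThree ModularGroup.T) 1 = v 0 + v 1 := by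
        simp [modThree, Matrix.vecMul, dotProduct, Fin.sum_univ_two, ModularGroup.T]
      rw [pointFamily, pointFamily, e0, e1]
      change intSlash m !![1, 1; 0, 1] _ = _
      rcases hcases (v 0) with hx | hx | hx <;> rcases hcases (v 1) with hy | hy | hy <;>
        rw [hx, hy] at hv' ⊢ <;>
        simp [d0, d1, d2, d3, d4, d5, d6, ← hu, hTu, hTw] at hv' ⊢ <;> abel⟩
    ⟨-g, fun v hv => by
      have hv' : ¬ (v 0 = 0 ∧ v 1 = 0) := fun h => hv (by ext i; fin_cases i <;> simp [h])
      have e0 : Matrix.vecMul v (modThree (lowerUnip 2)) 0 = v 0 + 2 * v 1 := by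
        simp [modThree, Matrix.vecMul, dotProduct, Fin.sum_univ_two, lowerUnip, mul_comm]
      have e1 : Matrix.vecMul v (modThree (lowerUnip 2)) 1 = v 1 := by
        simp [modThree, Matrix.vecMul, dotProduct, Fin.sum_univ_two, lowerUnip]
      rw [pointFamily, pointFamily, e0, e1]
      change intSlash m !![1, 0; 2, 1] _ = _
      rcases hcases (v 0) with hx | hx | hx <;> rcases hcases (v 1) with hy | hy | hy <;>
        rw [hx, hy] at hv' ⊢ <;>
        simp [d0, d1, d2, d3, d4, d5, d6, d7, hSg, hSu, hSw] at hv' ⊢ <;> abel⟩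
  intro γ hγ hb hc
  obtain ⟨r, hr⟩ := hle hγ
  have ha : (γ 0 0 : ZMod 3) = 1 ∧ (γ 1 1 : ZMod 3) = 1 ∨
      (γ 0 0 : ZMod 3) = -1 ∧ (γ 1 1 : ZMod 3) = -1 := by
    have h := γ.det_coe
    rw [Matrix.det_fin_two] at h
    have h' := congrArg (Int.cast : ℤ → ZMod 3) h
    push_cast at h'
    rw [(ZMod.intCast_zmod_eq_zero_iff_dvd (γ 1 0) 3).mpr hc, mul_zero, sub_zero] at h'
    generalize (γ 0 0 : ZMod 3) = a at *
    generalize (γ 1 1 : ZMod 3) = d at *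
    revert a d
    decide
  have hb' := (ZMod.intCast_zmod_eq_zero_iff_dvd (γ 0 1) 3).mpr hb
  have hc' := (ZMod.intCast_zmod_eq_zero_iff_dvd (γ 1 0) 3).mpr hc
  have hF : ∀ y : ZMod 3, pointFamily g u w (Matrix.vecMul ![1, y] (modThree γ)) =
      pointFamily g u w ![1, y] := by
    intro y
    rw [pointFamily, pointFamily]
    rcases ha with ⟨h0, h1⟩ | ⟨h0, h1⟩ <;>
      simp [Matrix.vecMul, dotProduct, Fin.sum_univ_two, modThree, h0, h1, hb', hc', neg_inj]
  have h1 := hr ![1, 1] (by decide)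
  have h2 := hr ![1, 2] (by decide)
  rw [hF] at h1 h2
  have v1 : pointFamily g u w ![1, 1] = g := by simp [pointFamily]
  have v2 : pointFamily g u w ![1, 2] = 0 := by
    simp [pointFamily, show (2 : ZMod 3) ≠ 0 by decide, show (1 : ZMod 3) ≠ 2 by decide]
  rw [v1] at h1
  rw [v2, map_zero, zero_add] at h2
  rw [h1, ← h2, add_zero]

end

section

open UpperHalfPlane hiding I
open CongruenceSubgroup

/-! ### From Fricke and Hecke relations to invariance under `Γ₀(N)` -/

/-- Passage between level `N` and level `N / h²` by the dilation `z ↦ z / h`. -/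
lemma intSlash_eq_self_of_dilate {m : ℕ} {f : ℍ → ℂ} {h c : ℤ} (hh : 0 < h) (γ : SL(2, ℤ))
    (hc : γ 1 0 = h * c)
    (H : ∀ δ : SL(2, ℤ), δ 0 1 = h * γ 0 1 → δ 1 0 = c → δ 0 0 = γ 0 0 → δ 1 1 = γ 1 1 →
      intSlash m δ (intSlash m !![1, 0; 0, h] f) = intSlash m !![1, 0; 0, h] f) :
    intSlash m γ f = f := by
  have hdet := γ.det_coe
  rw [Matrix.det_fin_two, hc] at hdet
  have hd : 0 < (!![1, 0; 0, h] : Matrix (Fin 2) (Fin 2) ℤ).det := by simpa using hh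
  let δ : SL(2, ℤ) := ⟨!![γ 0 0, h * γ 0 1; c, γ 1 1], by rw [Matrix.det_fin_two_of]; linarith⟩
  have e := H δ rfl rfl rfl rfl
  have hδ : 0 < (δ : Matrix (Fin 2) (Fin 2) ℤ).det := by rw [δ.det_coe]; exact one_pos
  apply intSlash_injective m hd
  rw [← e, intSlash_intSlash m hd hδ, intSlash_intSlash m (by simp) hd]
  congr 2
  ext i j
  fin_cases i <;> fin_cases j <;>
    simp [δ, hc, mul_comm, Matrix.mul_apply, Fin.sum_univ_two]

theorem intSlash_eq_of_level_twenty {m : ℕ} {f : ℍ → ℂ} (hm : 0 < m) (hf : Holo f)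
    (hT : intSlash m !![1, 1; 0, 1] f = f) (hT2 : intSlash m !![2, 1; 0, 2] f = -f)
    (hW : intSlash m !![0, -1; 20, 0] f = f) {l : ℂ}
    (hH : intSlash m !![3, 0; 0, 1] f + (intSlash m !![1, 0; 0, 3] f +
      intSlash m !![1, 1; 0, 3] f + intSlash m !![1, 2; 0, 3] f) = l • f) :
    ∀ γ ∈ Gamma0 20, intSlash m γ f = f := by
  have h2 : intSlash m !![1, 2; 0, 3] f = intSlash m !![1, -1; 0, 3] f := by
    rw [← intSlash_comp (A := !![1, 1; 0, 1]) (B := !![1, -1; 0, 3]) _ 1 1, hT]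
  have key := intSlash_eq_of_level_five (g := intSlash m !![1, 0; 0, 2] f) (l := l) hm
    (hf.intSlash m (by decide))
    (by rw [intSlash_comp !![1, 1; 0, 2] 1 1,
      ← intSlash_comp (A := !![2, 1; 0, 2]) (B := !![1, 0; 0, 2]) _ 2 1, hT2, map_neg])
    (by rw [intSlash_comp !![0, -1; 10, 0] 1 1,
      ← intSlash_comp (A := !![0, -1; 20, 0]) (B := !![1, 0; 0, 2]) _ 2 1, hW])
    (by
      rw [← map_smul, ← hH, h2]
      simp only [map_add]
      rw [intSlash_comp (A := !![1, 0; 0, 2]) !![3, 0; 0, 2] 1 1,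
        intSlash_comp (A := !![1, 0; 0, 2]) !![1, 0; 0, 6] 1 1,
        intSlash_comp (A := !![1, 0; 0, 2]) !![1, 2; 0, 6] 1 1,
        intSlash_comp (A := !![1, 0; 0, 2]) !![1, -2; 0, 6] 1 1,
        intSlash_comp (A := !![3, 0; 0, 1]) !![3, 0; 0, 2] 1 1,
        intSlash_comp (A := !![1, 0; 0, 3]) !![1, 0; 0, 6] 1 1,
        intSlash_comp (A := !![1, 1; 0, 3]) !![1, 2; 0, 6] 1 1,
        intSlash_comp (A := !![1, -1; 0, 3]) !![1, -2; 0, 6] 1 1]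
      abel)
  intro γ hγ
  obtain ⟨x, hx⟩ := mem_Gamma0_iff_dvd.mp hγ
  refine intSlash_eq_self_of_dilate (h := 2) (c := 10 * x) (by norm_num) γ
    (by rw [hx]; push_cast; ring) fun δ hb hc ha hd => ?_
  rw [key δ (mem_Gamma0_iff_dvd.mpr ⟨2 * x, by rw [hc]; push_cast; ring⟩), signMod2, hb, hc,
    Even.neg_one_zpow ⟨δ 0 0 * γ 0 1 + 10 * γ 0 1 * x + 5 * x * δ 1 1, by ring⟩, one_smul]

theorem intSlash_eq_of_level_twentyFour {m : ℕ} {f : ℍ → ℂ} (hm : 0 < m) (hf : Holo f)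
    (hT : intSlash m !![1, 1; 0, 1] f = f) (hT2 : intSlash m !![2, 1; 0, 2] f = -f)
    (hW : intSlash m !![0, -1; 24, 0] f = f) {l : ℂ}
    (hH : intSlash m !![5, 0; 0, 1] f + (intSlash m !![1, 0; 0, 5] f +
      intSlash m !![1, 1; 0, 5] f + intSlash m !![1, 2; 0, 5] f +
      intSlash m !![1, 3; 0, 5] f + intSlash m !![1, 4; 0, 5] f) = l • f) :
    ∀ γ ∈ Gamma0 24, intSlash m γ f = f := by
  have h3 : intSlash m !![1, 3; 0, 5] f = intSlash m !![1, -2; 0, 5] f := by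
    rw [← intSlash_comp (A := !![1, 1; 0, 1]) (B := !![1, -2; 0, 5]) _ 1 1, hT]
  have h4 : intSlash m !![1, 4; 0, 5] f = intSlash m !![1, -1; 0, 5] f := by
    rw [← intSlash_comp (A := !![1, 1; 0, 1]) (B := !![1, -1; 0, 5]) _ 1 1, hT]
  have key := intSlash_eq_of_level_six (g := intSlash m !![1, 0; 0, 2] f) (l := l) hm
    (hf.intSlash m (by decide))
    (by rw [intSlash_comp !![1, 1; 0, 2] 1 1,
      ← intSlash_comp (A := !![2, 1; 0, 2]) (B := !![1, 0; 0, 2]) _ 2 1, hT2, map_neg])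
    (by rw [intSlash_comp !![0, -1; 12, 0] 1 1,
      ← intSlash_comp (A := !![0, -1; 24, 0]) (B := !![1, 0; 0, 2]) _ 2 1, hW])
    (by
      rw [← map_smul, ← hH, h3, h4]
      simp only [map_add]
      rw [intSlash_comp (A := !![1, 0; 0, 2]) !![5, 0; 0, 2] 1 1,
        intSlash_comp (A := !![1, 0; 0, 2]) !![1, 0; 0, 10] 1 1,
        intSlash_comp (A := !![1, 0; 0, 2]) !![1, 2; 0, 10] 1 1,
        intSlash_comp (A := !![1, 0; 0, 2]) !![1, -2; 0, 10] 1 1,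
        intSlash_comp (A := !![1, 0; 0, 2]) !![1, 4; 0, 10] 1 1,
        intSlash_comp (A := !![1, 0; 0, 2]) !![1, -4; 0, 10] 1 1,
        intSlash_comp (A := !![5, 0; 0, 1]) !![5, 0; 0, 2] 1 1,
        intSlash_comp (A := !![1, 0; 0, 5]) !![1, 0; 0, 10] 1 1,
        intSlash_comp (A := !![1, 1; 0, 5]) !![1, 2; 0, 10] 1 1,
        intSlash_comp (A := !![1, 2; 0, 5]) !![1, 4; 0, 10] 1 1,
        intSlash_comp (A := !![1, -2; 0, 5]) !![1, -4; 0, 10] 1 1,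
        intSlash_comp (A := !![1, -1; 0, 5]) !![1, -2; 0, 10] 1 1]
      abel)
  intro γ hγ
  obtain ⟨x, hx⟩ := mem_Gamma0_iff_dvd.mp hγ
  refine intSlash_eq_self_of_dilate (h := 2) (c := 12 * x) (by norm_num) γ
    (by rw [hx]; push_cast; ring) fun δ hb hc ha hd => ?_
  rw [key δ (mem_Gamma0_iff_dvd.mpr ⟨2 * x, by rw [hc]; push_cast; ring⟩), signGamma0Two, hb, hc,
    show 12 * x / 2 = 6 * x by omega,
    Even.neg_one_zpow ⟨γ 0 1 + 3 * x, by ring⟩, one_smul]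

theorem intSlash_eq_of_level_eighteen {m : ℕ} {f : ℍ → ℂ}
    (hT : intSlash m !![1, 1; 0, 1] f = f)
    (hT3 : f + intSlash m !![3, 1; 0, 3] f + intSlash m !![3, 2; 0, 3] f = 0)
    (hW : intSlash m !![0, -1; 18, 0] f = f)
    (hU : intSlash m !![1, 0; 0, 2] f + intSlash m !![1, 1; 0, 2] f = f) :
    ∀ γ ∈ Gamma0 18, intSlash m γ f = f := by
  -- the Atkin–Lehner involution at `9`, obtained by comparing `U₂` with its Fricke conjugate
  have hA : intSlash m !![9, -5; 18, -9] f = -f := by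
    have h1 := congrArg (intSlash m !![0, -1; 18, 0]) hU
    rw [map_add, hW, intSlash_comp (A := !![1, 0; 0, 2]) !![0, -1; 36, 0] 1 1,
      ← intSlash_comp (A := !![0, -1; 18, 0]) (B := !![2, 0; 0, 1]) !![0, -1; 36, 0] 1 1, hW,
      intSlash_comp (A := !![1, 1; 0, 2]) !![18, -1; 36, 0] 1 1] at h1
    have h2 := congrArg (intSlash m !![1, 0; 0, 2]) h1
    rw [map_add, intSlash_comp (A := !![2, 0; 0, 1]) 1 2 1, intSlash_one,
      intSlash_comp (A := !![18, -1; 36, 0]) !![9, -1; 18, 0] 2 1,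
      eq_sub_of_add_eq hU, sub_eq_add_neg, add_right_inj] at h2
    have h3 := congrArg (intSlash m !![2, -1; 0, 1]) h2
    rwa [map_neg, intSlash_comp (A := !![1, 1; 0, 2]) 1 2 1, intSlash_one,
      intSlash_comp (A := !![9, -1; 18, 0]) !![9, -5; 18, -9] 2 1] at h3
  have hT1' : intSlash m !![1, 1; 0, 1] (intSlash m !![1, 0; 0, 3] f) =
      intSlash m !![1, 0; 0, 3] (intSlash m !![3, 1; 0, 3] f) := by
    rw [intSlash_comp !![1, 1; 0, 3] 1 1, intSlash_comp !![1, 1; 0, 3] 3 1]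
  have hT2' : intSlash m !![1, 2; 0, 1] (intSlash m !![1, 0; 0, 3] f) =
      intSlash m !![1, 0; 0, 3] (intSlash m !![3, 2; 0, 3] f) := by
    rw [intSlash_comp !![1, 2; 0, 3] 1 1, intSlash_comp !![1, 2; 0, 3] 3 1]
  have key := intSlash_eq_of_level_two (g := intSlash m !![1, 0; 0, 3] f)
    (by rw [hT1', hT2', ← map_add, ← map_add, hT3, map_zero])
    (by rw [intSlash_comp !![1, 3; 0, 3] 1 1,
      ← intSlash_comp (A := !![1, 1; 0, 1]) (B := !![1, 0; 0, 3]) _ 1 1, hT])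
    (by rw [intSlash_comp !![0, -1; 6, 0] 1 1,
      ← intSlash_comp (A := !![0, -1; 18, 0]) (B := !![1, 0; 0, 3]) _ 3 1, hW])
    (by rw [intSlash_comp !![3, -5; 6, -9] 1 1,
      ← intSlash_comp (A := !![9, -5; 18, -9]) (B := !![1, 0; 0, 3]) _ 3 1, hA, map_neg])
  intro γ hγ
  obtain ⟨x, hx⟩ := mem_Gamma0_iff_dvd.mp hγ
  refine intSlash_eq_self_of_dilate (h := 3) (c := 6 * x) (by norm_num) γ
    (by rw [hx]; push_cast; ring) fun δ hb hc ha hd => ?_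
  exact key δ (mem_Gamma0_iff_dvd.mpr ⟨3 * x, by rw [hc]; push_cast; ring⟩)
    ⟨_, hb⟩ ⟨2 * x, by rw [hc]; ring⟩

end

section

open Complex

/-! ### Coefficients of an Euler product of degree two -/

/-- The coefficients of the power series `(1 - α X + β X²)⁻¹`. -/
noncomputable def quadCoeff (α β : ℂ) : ℕ → ℂ
  | 0 => 1
  | 1 => α
  | e + 2 => α * quadCoeff α β (e + 1) - β * quadCoeff α β e

lemma norm_quadCoeff_le {α β : ℂ} {B : ℝ} (hB : 0 ≤ B) (hα : ‖α‖ ≤ B) (hβ : ‖β‖ ≤ B ^ 2) (e : ℕ) :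
    ‖quadCoeff α β e‖ ≤ (2 * B) ^ e := by
  induction e using Nat.twoStepInduction with
  | zero => simp [quadCoeff]
  | one => rw [quadCoeff, pow_one]; linarith
  | more e h1 h2 =>
    rw [quadCoeff]
    calc _ ≤ ‖α‖ * ‖quadCoeff α β (e + 1)‖ + ‖β‖ * ‖quadCoeff α β e‖ := by
          rw [← norm_mul, ← norm_mul]; exact norm_sub_le _ _
      _ ≤ B * (2 * B) ^ (e + 1) + B ^ 2 * (2 * B) ^ e := by gcongr
      _ ≤ (2 * B) ^ (e + 2) := by
          have : 0 ≤ (2 * B) ^ e * B ^ 2 := by positivity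
          rw [pow_succ, pow_add]; nlinarith

lemma tsum_quadCoeff_mul_pow {α β x : ℂ} (h : Summable fun e => quadCoeff α β e * x ^ e) :
    ∑' e, quadCoeff α β e * x ^ e = (1 - α * x + β * x ^ 2)⁻¹ := by
  have h1 := h.tsum_eq_zero_add
  have hs1 : Summable fun e => quadCoeff α β (e + 1) * x ^ (e + 1) :=
    (summable_nat_add_iff 1).mpr h
  have h2 := hs1.tsum_eq_zero_add
  have h3 : ∑' e, quadCoeff α β (e + 1 + 1) * x ^ (e + 1 + 1) =
      α * x * ∑' e, quadCoeff α β (e + 1) * x ^ (e + 1) -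
        β * x ^ 2 * ∑' e, quadCoeff α β e * x ^ e := by
    rw [← tsum_mul_left, ← tsum_mul_left, ← (hs1.mul_left _).tsum_sub (h.mul_left _)]
    refine tsum_congr fun e => ?_
    rw [quadCoeff]
    ring
  rw [h3] at h2
  simp only [quadCoeff, pow_zero, zero_add, pow_one, mul_one] at h1 h2
  refine eq_inv_of_mul_eq_one_left ?_
  linear_combination (1 - α * x) * h1 + h2

/-- The multiplicative function whose values at the powers of `p` are the coefficients of
`(1 - α_p X + β_p X²)⁻¹`. -/
noncomputable def eulerCoeff (α β : ℕ → ℂ) (n : ℕ) : ℂ :=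
  n.factorization.prod fun p e => quadCoeff (α p) (β p) e

variable {α β : ℕ → ℂ}

lemma eulerCoeff_one : eulerCoeff α β 1 = 1 := by simp [eulerCoeff]

lemma eulerCoeff_mul {m n : ℕ} (h : m.Coprime n) :
    eulerCoeff α β (m * n) = eulerCoeff α β m * eulerCoeff α β n := by
  rw [eulerCoeff, Nat.factorization_mul_of_coprime h,
    Finsupp.prod_add_index_of_disjoint (by simpa using h.disjoint_primeFactors)]
  rfl

lemma eulerCoeff_prime_pow {p : ℕ} (hp : p.Prime) (e : ℕ) :
    eulerCoeff α β (p ^ e) = quadCoeff (α p) (β p) e := by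
  rw [eulerCoeff, hp.factorization_pow, Finsupp.prod_single_index (by rfl)]

/-- The Hecke relation satisfied by the coefficients of an Euler product of degree two. -/
lemma eulerCoeff_prime_mul {p : ℕ} (hp : p.Prime) {n : ℕ} (hn : n ≠ 0) :
    eulerCoeff α β (p * n) = α p * eulerCoeff α β n -
      β p * if p ∣ n then eulerCoeff α β (n / p) else 0 := by
  obtain ⟨e, n', hn', rfl⟩ := Nat.exists_eq_pow_mul_and_not_dvd hn p hp.ne_one
  have hc : ∀ e, (p ^ e).Coprime n' := fun e =>
    Nat.Coprime.pow_left e ((Nat.Prime.coprime_iff_not_dvd hp).mpr hn')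
  have key : ∀ e, eulerCoeff α β (p ^ e * n') = quadCoeff (α p) (β p) e * eulerCoeff α β n' :=
    fun e => by rw [eulerCoeff_mul (hc e), eulerCoeff_prime_pow hp]
  rw [← mul_assoc, ← pow_succ', key, key]
  cases e with
  | zero => simp [hn', quadCoeff]
  | succ e =>
    rw [if_pos (Dvd.dvd.mul_right (dvd_pow_self p (by simp)) _), pow_succ', mul_assoc,
      Nat.mul_div_cancel_left _ hp.pos, key, quadCoeff]
    ring

lemma norm_eulerCoeff_le {M : ℕ} (hα : ∀ p : ℕ, p.Prime → ‖α p‖ ≤ (p : ℝ) ^ M)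
    (hβ : ∀ p : ℕ, p.Prime → ‖β p‖ ≤ ((p : ℝ) ^ M) ^ 2) {n : ℕ} (hn : n ≠ 0) :
    ‖eulerCoeff α β n‖ ≤ (n : ℝ) ^ (M + 1) := by
  have hprod : (n : ℝ) ^ (M + 1) = n.factorization.prod fun p e => ((p : ℝ) ^ e) ^ (M + 1) := by
    conv_lhs => rw [← Nat.prod_factorization_pow_eq_self hn]
    rw [Finsupp.prod, Finsupp.prod]
    push_cast
    rw [Finset.prod_pow]
  rw [hprod, eulerCoeff, Finsupp.prod, Finsupp.prod, norm_prod]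
  refine Finset.prod_le_prod (fun _ _ => norm_nonneg _) fun p hp => ?_
  have hp' : p.Prime := Nat.prime_of_mem_primeFactors (by simpa using hp)
  refine (norm_quadCoeff_le (by positivity) (hα p hp') (hβ p hp') _).trans ?_
  rw [← pow_mul, mul_comm (n.factorization p), pow_mul]
  refine pow_le_pow_left₀ (by positivity) ?_ _
  rw [pow_succ, mul_comm]
  gcongr
  exact_mod_cast hp'.two_le

/-- Two absolutely convergent expansions, a Dirichlet series and an Euler product of degree two,
determine each other. -/
theorem eq_eulerCoeff_of_hasProd {M : ℕ} (hα : ∀ p : ℕ, p.Prime → ‖α p‖ ≤ (p : ℝ) ^ M)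
    (hβ : ∀ p : ℕ, p.Prime → ‖β p‖ ≤ ((p : ℝ) ^ M) ^ 2) {a : ℕ → ℂ} {x₀ : ℝ}
    (ha : LSeries.abscissaOfAbsConv a < ⊤)
    (hprod : ∀ s : ℂ, x₀ < s.re → HasProd (fun p : Nat.Primes =>
      (1 - α p * (p : ℂ) ^ (-s) + β p * ((p : ℂ) ^ (-s)) ^ 2)⁻¹) (LSeries a s))
    {n : ℕ} (hn : n ≠ 0) : a n = eulerCoeff α β n := by
  have hsum : ∀ s : ℂ, (M + 2 : ℝ) < s.re → LSeriesSummable (eulerCoeff α β) s := by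
    intro s hs
    refine LSeriesSummable_of_le_const_mul_rpow (x := M + 2) hs ⟨1, fun n hn => ?_⟩
    rw [one_mul, show (M + 2 : ℝ) - 1 = ((M + 1 : ℕ) : ℝ) by push_cast; ring, Real.rpow_natCast]
    exact norm_eulerCoeff_le hα hβ hn
  have hb : LSeries.abscissaOfAbsConv (eulerCoeff α β) < ⊤ := by
    refine lt_of_le_of_lt (hsum (M + 3 : ℝ) (by norm_num)).abscissaOfAbsConv_le (EReal.coe_lt_top _)
  refine LSeries.eq_of_LSeries_eventually_eq ha hb ?_ hn
  filter_upwards [Filter.eventually_gt_atTop x₀, Filter.eventually_gt_atTop (M + 2 : ℝ)]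
    with x hx hx'
  have hsx := hsum x (by simpa using hx')
  refine (hprod x (by simpa using hx)).unique ?_
  have hmul : ∀ {m n : ℕ}, m.Coprime n → LSeries.term (eulerCoeff α β) x (m * n) =
      LSeries.term (eulerCoeff α β) x m * LSeries.term (eulerCoeff α β) x n := by
    intro m n hmn
    rcases eq_or_ne m 0 with rfl | hm
    · simp
    rcases eq_or_ne n 0 with rfl | hn
    · simp
    rw [LSeries.term_of_ne_zero (mul_ne_zero hm hn), LSeries.term_of_ne_zero hm,
      LSeries.term_of_ne_zero hn, eulerCoeff_mul hmn, Nat.cast_mul, natCast_mul_natCast_cpow,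
      div_mul_div_comm]
  have h := EulerProduct.eulerProduct_hasProd (f := LSeries.term (eulerCoeff α β) x)
    (by rw [LSeries.term_of_ne_zero one_ne_zero, eulerCoeff_one]; simp) hmul hsx.norm (by simp)
  rw [LSeries]
  convert h using 2 with p
  have hterm : ∀ e : ℕ, LSeries.term (eulerCoeff α β) x ((p : ℕ) ^ e) =
      quadCoeff (α p) (β p) e * ((p : ℂ) ^ (-x : ℂ)) ^ e := by
    intro e
    rw [LSeries.term_of_ne_zero (pow_ne_zero _ p.2.ne_zero), eulerCoeff_prime_pow p.2, cpow_neg,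
      inv_pow, div_eq_mul_inv]
    congr 2
    rw [Nat.cast_pow, ← natCast_cpow_natCast_mul, ← cpow_nat_mul]
  simp_rw [hterm]
  rw [tsum_quadCoeff_mul_pow]
  have hinj : Function.Injective fun e : ℕ => (p : ℕ) ^ e := Nat.pow_right_injective p.2.two_le
  simpa [Function.comp_def, hterm] using hsx.comp_injective hinj

end

section

open Complex

/-! ### The Hecke relations for the coefficients -/

/-- The linear coefficient of the Euler factor of `eulerFactor` at `p`, in weight `2m`. -/
noncomputable def linCoeff (N m : ℕ) (a : ℕ → ℂ) (p : ℕ) : ℂ :=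
  if ¬ p ∣ N then a p else if ¬ p ^ 2 ∣ N then (p : ℂ) ^ (m - 1) else 0

/-- The quadratic coefficient of the Euler factor of `eulerFactor` at `p`, in weight `2m`. -/
noncomputable def sqCoeff (N m : ℕ) (p : ℕ) : ℂ :=
  if ¬ p ∣ N then (p : ℂ) ^ (2 * m - 1) else 0

lemma eulerFactor_eq {m : ℕ} (hm : 0 < m) (N : ℕ) (a : ℕ → ℂ) {p : ℕ} (hp : p.Prime) (s : ℂ) :
    eulerFactor N (2 * m) a p s =
      (1 - linCoeff N m a p * (p : ℂ) ^ (-s) + sqCoeff N m p * ((p : ℂ) ^ (-s)) ^ 2)⁻¹ := by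
  have hp0 : (p : ℂ) ≠ 0 := by exact_mod_cast hp.ne_zero
  have e1 : (p : ℂ) ^ (((2 * m : ℕ) : ℂ) - 1 - 2 * s) =
      (p : ℂ) ^ (2 * m - 1) * ((p : ℂ) ^ (-s)) ^ 2 := by
    rw [sub_eq_add_neg, cpow_add _ _ hp0, ← cpow_nat_mul, ← cpow_natCast,
      Nat.cast_sub (by omega)]
    push_cast
    ring_nf
  have e2 : (p : ℂ) ^ (((2 * m : ℕ) : ℂ) / 2 - 1 - s) = (p : ℂ) ^ (m - 1) * (p : ℂ) ^ (-s) := by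
    rw [sub_eq_add_neg, cpow_add _ _ hp0, ← cpow_natCast, Nat.cast_sub (by omega)]
    congr 2
    push_cast
    ring
  rw [eulerFactor, linCoeff, sqCoeff, e1, e2]
  split_ifs <;> simp

lemma exists_norm_le_pow {a : ℕ → ℂ} {σ : ℝ}
    (ha : a =O[Filter.atTop] fun n : ℕ => (n : ℝ) ^ σ) :
    ∃ M : ℕ, ∀ n : ℕ, 2 ≤ n → ‖a n‖ ≤ (n : ℝ) ^ M := by
  obtain ⟨C, hC, h⟩ := Asymptotics.bound_of_isBigO_nat_atTop ha
  obtain ⟨r, hr⟩ := pow_unbounded_of_one_lt C (one_lt_two : (1 : ℝ) < 2)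
  refine ⟨r + ⌈σ⌉₊, fun n hn => ?_⟩
  have hn' : (2 : ℝ) ≤ n := by exact_mod_cast hn
  have hpos : 0 < (n : ℝ) ^ σ := Real.rpow_pos_of_pos (by linarith) _
  refine (h hpos.ne').trans ?_
  rw [Real.norm_of_nonneg hpos.le, pow_add]
  gcongr
  · exact hr.le.trans (by gcongr)
  · rw [← Real.rpow_natCast]
    exact Real.rpow_le_rpow_of_exponent_le (by linarith) (Nat.le_ceil _)

/-- The Hecke relations between the coefficients of a Dirichlet series with the given Euler
product. -/
theorem coeff_prime_mul {N m : ℕ} (hm : 0 < m) {a : ℕ → ℂ} {σ : ℝ}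
    (ha : a =O[Filter.atTop] fun n : ℕ => (n : ℝ) ^ σ)
    (heuler : ∀ s : ℂ, σ + 1 < s.re →
      HasProd (fun p : Nat.Primes => eulerFactor N (2 * m) a p s) (LSeries a s))
    {p : ℕ} (hp : p.Prime) {n : ℕ} (hn : n ≠ 0) :
    a (p * n) = linCoeff N m a p * a n - sqCoeff N m p * if p ∣ n then a (n / p) else 0 := by
  obtain ⟨M, hM⟩ := exists_norm_le_pow ha
  have h1 : ∀ q : ℕ, q.Prime → (1 : ℝ) ≤ q := fun q hq => by exact_mod_cast hq.one_le
  have hα : ∀ q : ℕ, q.Prime → ‖linCoeff N m a q‖ ≤ (q : ℝ) ^ (M + m) := by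
    intro q hq
    rw [linCoeff]
    split_ifs
    · simp
    · rw [norm_pow, norm_natCast]
      exact pow_le_pow_right₀ (h1 q hq) (by omega)
    · exact (hM q hq.two_le).trans (pow_le_pow_right₀ (h1 q hq) (by omega))
  have hβ : ∀ q : ℕ, q.Prime → ‖sqCoeff N m q‖ ≤ ((q : ℝ) ^ (M + m)) ^ 2 := by
    intro q hq
    rw [sqCoeff, ← pow_mul]
    split_ifs
    · simp
    · rw [norm_pow, norm_natCast]
      exact pow_le_pow_right₀ (h1 q hq) (by omega)
  have key : ∀ {n : ℕ}, n ≠ 0 → a n = eulerCoeff (linCoeff N m a) (sqCoeff N m) n :=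
    fun hn => eq_eulerCoeff_of_hasProd hα hβ
      ((LSeries.abscissaOfAbsConv_le_of_isBigO_rpow ha).trans_lt
        (by exact_mod_cast EReal.coe_lt_top (σ + 1)))
      (fun s hs => by
        convert heuler s hs using 2 with p
        exact (eulerFactor_eq hm N a p.2 s).symm) hn
  rw [key (mul_ne_zero hp.ne_zero hn), eulerCoeff_prime_mul hp hn, ← key hn]
  split_ifs with h
  · rw [← key (Nat.div_pos (Nat.le_of_dvd (Nat.pos_of_ne_zero hn) h) hp.pos).ne']
  · rfl

end

section

open UpperHalfPlane hiding I
open Complex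
open scoped Nat

/-! ### `q`-series with coefficients of polynomial growth -/

/-- The function `∑ a_n exp(2πinw)` of a complex variable `w`, meant for `Im w > 0`. -/
noncomputable def qSeries (a : ℕ → ℂ) (w : ℂ) : ℂ := ∑' n : ℕ, a n * cexp (2 * Real.pi * I * n * w)

/-- Coefficients of polynomial growth. The exponent is positive, so that the constant term
vanishes. -/
def PolyGrowth (a : ℕ → ℂ) : Prop := ∃ C : ℝ, ∃ A : ℕ, ∀ n, ‖a n‖ ≤ C * (n : ℝ) ^ (A + 1)

lemma PolyGrowth.coeff_zero {a : ℕ → ℂ} (ha : PolyGrowth a) : a 0 = 0 := by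
  obtain ⟨C, A, h⟩ := ha
  simpa using h 0

lemma norm_qTerm_le {a : ℕ → ℂ} {C : ℝ} {A : ℕ} (ha : ∀ n, ‖a n‖ ≤ C * (n : ℝ) ^ (A + 1))
    {B : ℕ} (hB : A + 3 ≤ B) {w : ℂ} {y : ℝ} (hy : 0 < y) (hw : y ≤ w.im) (n : ℕ) :
    ‖a n * cexp (2 * Real.pi * I * n * w)‖ ≤
      C * (B ! / (2 * Real.pi * y) ^ B) * ((n : ℝ) ^ 2)⁻¹ := by
  have hC : 0 ≤ C := by simpa using (norm_nonneg _).trans (ha 1)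
  rcases n.eq_zero_or_pos with rfl | hn
  · have := ha 0
    simp at this
    simp [this]
  have hn' : (1 : ℝ) ≤ n := by exact_mod_cast hn
  have ht : 0 < 2 * Real.pi * y * n := by positivity
  have h1 : ‖cexp (2 * Real.pi * I * n * w)‖ ≤ B ! / (2 * Real.pi * y * n) ^ B := by
    have h2 := Real.pow_div_factorial_le_exp _ ht.le B
    have h3 : ‖cexp (2 * Real.pi * I * n * w)‖ ≤ (Real.exp (2 * Real.pi * y * n))⁻¹ := by
      rw [Complex.norm_exp, ← Real.exp_neg, Real.exp_le_exp]
      have : (2 * Real.pi * I * n * w).re = - (2 * Real.pi * w.im * n) := by simp; ring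
      rw [this]
      gcongr
    refine h3.trans ?_
    rw [← inv_div]
    exact inv_anti₀ (by positivity) h2
  rw [norm_mul]
  calc _ ≤ C * (n : ℝ) ^ (A + 1) * (B ! / (2 * Real.pi * y * n) ^ B) := by
        gcongr
        exact ha n
    _ = C * (B ! / (2 * Real.pi * y) ^ B) * ((n : ℝ) ^ (A + 1) / (n : ℝ) ^ B) := by
        rw [mul_pow]; field_simp
    _ ≤ _ := by
        gcongr
        rw [div_le_iff₀ (by positivity), ← div_eq_inv_mul, le_div_iff₀ (by positivity), ← pow_add]
        exact pow_le_pow_right₀ hn' hB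

lemma PolyGrowth.summable {a : ℕ → ℂ} (ha : PolyGrowth a) {w : ℂ} (hw : 0 < w.im) :
    Summable fun n : ℕ => a n * cexp (2 * Real.pi * I * n * w) := by
  obtain ⟨C, A, h⟩ := ha
  exact .of_norm_bounded ((Real.summable_nat_pow_inv.mpr one_lt_two).mul_left _)
    (norm_qTerm_le h le_rfl hw le_rfl)

lemma PolyGrowth.hasSum {a : ℕ → ℂ} (ha : PolyGrowth a) {w : ℂ} (hw : 0 < w.im) :
    HasSum (fun n : ℕ => a n * cexp (2 * Real.pi * I * n * w)) (qSeries a w) :=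
  (ha.summable hw).hasSum

/-- A `q`-series without constant term is `O(y ^ (-B))` on the whole upper half-plane for all
large `B`. This controls it both at the cusps and at `i∞`. -/
lemma PolyGrowth.exists_norm_qSeries_le {a : ℕ → ℂ} (ha : PolyGrowth a) :
    ∃ B₀ : ℕ, ∀ B ≥ B₀, ∃ K : ℝ, ∀ w : ℂ, 0 < w.im → ‖qSeries a w‖ ≤ K / w.im ^ B := by
  obtain ⟨C, A, h⟩ := ha
  refine ⟨A + 3, fun B hB => ⟨C * (B ! / (2 * Real.pi) ^ B) * ∑' n : ℕ, ((n : ℝ) ^ 2)⁻¹,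
    fun w hw => ?_⟩⟩
  have hs := (Real.summable_nat_pow_inv.mpr one_lt_two)
  refine (tsum_of_norm_bounded (hs.mul_left _).hasSum (norm_qTerm_le h hB hw le_rfl)).trans
    (le_of_eq ?_)
  rw [tsum_mul_left, mul_pow]
  field_simp

lemma PolyGrowth.differentiableOn {a : ℕ → ℂ} (ha : PolyGrowth a) :
    DifferentiableOn ℂ (qSeries a) {z | 0 < z.im} := by
  obtain ⟨C, A, h⟩ := ha
  intro w hw
  have ho : IsOpen {z : ℂ | w.im / 2 < z.im} := isOpen_lt continuous_const continuous_im
  have hw' : 0 < w.im / 2 := half_pos hw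
  have := differentiableOn_tsum_of_summable_norm
    (F := fun (n : ℕ) (w : ℂ) => a n * cexp (2 * Real.pi * I * n * w))
    ((Real.summable_nat_pow_inv.mpr one_lt_two).mul_left _) (fun n => by fun_prop) ho
    (fun n z hz => norm_qTerm_le h le_rfl hw' (le_of_lt hz) n)
  have hmem : w.im / 2 < w.im := half_lt_self hw
  exact (this.differentiableAt (ho.mem_nhds hmem)).differentiableWithinAt

lemma qSeries_add_one (a : ℕ → ℂ) (w : ℂ) : qSeries a (w + 1) = qSeries a w := by
  refine tsum_congr fun n => ?_
  rw [mul_add, Complex.exp_add, mul_one, mul_comm _ (n : ℂ), Complex.exp_nat_mul_two_pi_mul_I,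
    mul_one]

lemma PolyGrowth.comp_mul {a : ℕ → ℂ} (ha : PolyGrowth a) (p : ℕ) :
    PolyGrowth fun n => a (p * n) := by
  obtain ⟨C, A, h⟩ := ha
  refine ⟨C * p ^ (A + 1), A, fun n => (h _).trans (le_of_eq ?_)⟩
  push_cast
  ring

lemma sum_exp_div_nat {p : ℕ} (hp : p ≠ 0) (n : ℕ) :
    ∑ b ∈ Finset.range p, cexp (2 * Real.pi * I * n * (b / p)) = if p ∣ n then (p : ℂ) else 0 := by
  have hp' : (p : ℂ) ≠ 0 := by exact_mod_cast hp
  set ζ : ℂ := cexp (2 * Real.pi * I * (n / p)) with hζ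
  have h1 : ∀ b : ℕ, cexp (2 * Real.pi * I * n * (b / p)) = ζ ^ b := by
    intro b
    rw [hζ, ← Complex.exp_nat_mul]
    ring_nf
  have hζp : ζ ^ p = 1 := by
    rw [← h1, div_self hp', mul_one, mul_comm _ (n : ℂ), Complex.exp_nat_mul_two_pi_mul_I]
  simp_rw [h1]
  split_ifs with h
  · obtain ⟨c, rfl⟩ := h
    have : ζ = 1 := by
      rw [hζ, Nat.cast_mul, mul_div_cancel_left₀ _ hp', mul_comm _ (c : ℂ),
        Complex.exp_nat_mul_two_pi_mul_I]
    simp [this]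
  · have : ζ ≠ 1 := by
      intro h0
      rw [hζ, Complex.exp_eq_one_iff] at h0
      obtain ⟨c, hc⟩ := h0
      have h2 : (n : ℂ) / p = c := by
        have := Complex.two_pi_I_ne_zero
        rw [mul_comm] at hc
        exact mul_right_cancel₀ this hc
      rw [div_eq_iff hp'] at h2
      apply h
      have : (n : ℤ) = c * p := by exact_mod_cast h2
      exact Int.natCast_dvd_natCast.mp ⟨c, by rw [this, mul_comm]⟩
    have h3 := mul_geom_sum ζ p
    rw [hζp, sub_self] at h3
    exact (mul_eq_zero.mp h3).resolve_left (sub_ne_zero.mpr this)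

lemma tsum_ite_dvd {p : ℕ} (hp : p ≠ 0) (g : ℕ → ℂ) :
    ∑' n : ℕ, (if p ∣ n then g n else 0) = ∑' n : ℕ, g (p * n) := by
  have hi : Function.Injective fun n : ℕ => p * n :=
    fun _ _ h => Nat.eq_of_mul_eq_mul_left (Nat.pos_of_ne_zero hp) h
  rw [← hi.tsum_eq]
  · simp
  · intro n hn
    by_contra h
    exact hn (if_neg fun ⟨c, hc⟩ => h ⟨c, hc.symm⟩)

/-- Averaging over translates by `b / p` extracts the coefficients with index divisible by `p`. -/
lemma PolyGrowth.sum_qSeries_div {a : ℕ → ℂ} (ha : PolyGrowth a) {p : ℕ} (hp : p ≠ 0) {w : ℂ}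
    (hw : 0 < w.im) :
    ∑ b ∈ Finset.range p, qSeries a ((w + b) / p) = p * qSeries (fun n => a (p * n)) w := by
  have hp' : (p : ℂ) ≠ 0 := by exact_mod_cast hp
  have him : ∀ b : ℕ, 0 < ((w + b) / p).im := by
    intro b
    have hp0 : (0 : ℝ) < p := by exact_mod_cast Nat.pos_of_ne_zero hp
    rw [← Complex.ofReal_natCast p, Complex.div_ofReal_im]
    simpa using div_pos hw hp0
  unfold qSeries
  rw [← Summable.tsum_finsetSum fun b _ => ha.summable (him b), ← tsum_mul_left]
  have : ∀ n : ℕ, ∑ b ∈ Finset.range p, a n * cexp (2 * Real.pi * I * n * ((w + b) / p)) =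
      if p ∣ n then p * (a n * cexp (2 * Real.pi * I * n * (w / p))) else 0 := by
    intro n
    have h := sum_exp_div_nat hp n
    have e : ∀ b : ℕ, a n * cexp (2 * Real.pi * I * n * ((w + b) / p)) =
        a n * cexp (2 * Real.pi * I * n * (w / p)) * cexp (2 * Real.pi * I * n * (b / p)) := by
      intro b
      rw [mul_assoc (a n), ← Complex.exp_add]
      ring_nf
    rw [Finset.sum_congr rfl fun b _ => e b, ← Finset.mul_sum, h]
    split_ifs <;> ring
  rw [tsum_congr this, tsum_ite_dvd hp]
  refine tsum_congr fun n => ?_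
  have : (2 * Real.pi * I * (p * n : ℕ) * (w / p) : ℂ) = 2 * Real.pi * I * n * w := by
    push_cast
    field_simp
  rw [this]

lemma qSeries_nat_mul (a : ℕ → ℂ) {p : ℕ} (hp : p ≠ 0) (w : ℂ) :
    qSeries a (p * w) = qSeries (fun n => if p ∣ n then a (n / p) else 0) w := by
  unfold qSeries
  simp_rw [ite_mul, zero_mul]
  rw [tsum_ite_dvd hp fun n => a (n / p) * cexp (2 * Real.pi * I * n * w)]
  refine tsum_congr fun n => ?_
  rw [Nat.mul_div_cancel_left _ (Nat.pos_of_ne_zero hp)]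
  push_cast
  ring_nf

end

section

open UpperHalfPlane hiding I
open Complex

/-! ### Hecke operators on `q`-series -/

/-- The restriction of `qSeries` to the upper half-plane. -/
noncomputable def qForm (a : ℕ → ℂ) (z : ℍ) : ℂ := qSeries a z

lemma PolyGrowth.holo {a : ℕ → ℂ} (ha : PolyGrowth a) : Holo (qForm a) :=
  ha.differentiableOn.congr fun w hw => by
    rw [Function.comp_apply, qForm, ofComplex_apply_of_im_pos hw]

lemma intSlash_qForm (m : ℕ) {A : Matrix (Fin 2) (Fin 2) ℤ} (hA : 0 < A.det) (a : ℕ → ℂ) (z : ℍ) :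
    intSlash m A (qForm a) z = (A.det : ℂ) ^ m / ((A 1 0 : ℂ) * z + A 1 1) ^ (2 * m) *
      qSeries a (((A 0 0 : ℂ) * z + A 0 1) / ((A 1 0 : ℂ) * z + A 1 1)) := by
  rw [intSlash_apply, qForm, coe_ofComplex_moebius hA]

lemma intSlash_translate_qForm (m : ℕ) (a : ℕ → ℂ) :
    intSlash m !![1, 1; 0, 1] (qForm a) = qForm a := by
  ext z
  rw [intSlash_qForm m (by decide)]
  simp [qSeries_add_one, qForm]

lemma PolyGrowth.sum_intSlash {a : ℕ → ℂ} (ha : PolyGrowth a) (m : ℕ) {p : ℕ} (hp : p ≠ 0) :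
    ∑ b ∈ Finset.range p, intSlash m !![1, (b : ℤ); 0, (p : ℤ)] (qForm a) =
      ((p : ℂ) / p ^ m) • qForm fun n => a (p * n) := by
  have hp' : (p : ℂ) ≠ 0 := by exact_mod_cast hp
  ext z
  rw [Finset.sum_apply, Pi.smul_apply, qForm, smul_eq_mul, div_mul_eq_mul_div,
    ← ha.sum_qSeries_div hp z.2, Finset.sum_div]
  refine Finset.sum_congr rfl fun b _ => ?_
  rw [intSlash_qForm m (by simp [Matrix.det_fin_two]; omega)]
  simp [Matrix.det_fin_two]
  field_simp
  ring

lemma intSlash_scale_qForm (m : ℕ) (a : ℕ → ℂ) {p : ℕ} (hp : p ≠ 0) :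
    intSlash m !![(p : ℤ), 0; 0, 1] (qForm a) =
      (p : ℂ) ^ m • qForm fun n => if p ∣ n then a (n / p) else 0 := by
  ext z
  rw [intSlash_qForm m (by simp [Matrix.det_fin_two]; omega), Pi.smul_apply, qForm,
    ← qSeries_nat_mul a hp]
  simp [Matrix.det_fin_two]

/-- If the coefficients at multiples of `p` vanish, then so does the average over the translates
by `b / p`. -/
lemma PolyGrowth.sum_intSlash_translate {a : ℕ → ℂ} (ha : PolyGrowth a) (m : ℕ) {p : ℕ}
    (hp : p ≠ 0) (h : ∀ n, a (p * n) = 0) :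
    ∑ b ∈ Finset.range p, intSlash m !![(p : ℤ), (b : ℤ); 0, (p : ℤ)] (qForm a) = 0 := by
  have h0 : (qForm fun n => a (p * n)) = 0 := by
    ext z
    simp [qForm, qSeries, h]
  have h1 := congrArg (intSlash m !![(p : ℤ), 0; 0, 1]) (ha.sum_intSlash m hp)
  rw [h0, smul_zero, map_zero, map_sum] at h1
  rw [← h1]
  refine Finset.sum_congr rfl fun b _ => ?_
  rw [intSlash_intSlash m (by simp [Matrix.det_fin_two]; omega)
    (by simp [Matrix.det_fin_two]; omega)]
  congr 2
  simp

lemma PolyGrowth.dvd_ite {a : ℕ → ℂ} (ha : PolyGrowth a) (p : ℕ) :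
    PolyGrowth fun n => if p ∣ n then a (n / p) else 0 := by
  obtain ⟨C, A, h⟩ := ha
  have hC : 0 ≤ C := by simpa using (norm_nonneg _).trans (h 1)
  refine ⟨C, A, fun n => ?_⟩
  dsimp only
  split_ifs
  · refine (h _).trans ?_
    gcongr
    exact Nat.div_le_self n p
  · rw [norm_zero]
    positivity

variable {N m : ℕ} {a : ℕ → ℂ} {σ : ℝ}

/-- The eigenvalue equation for the Hecke operator at a prime `p` not dividing the level. -/
lemma PolyGrowth.hecke_eigen (hp : PolyGrowth a) (hm : 0 < m)
    (ha : a =O[Filter.atTop] fun n : ℕ => (n : ℝ) ^ σ)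
    (heuler : ∀ s : ℂ, σ + 1 < s.re →
      HasProd (fun p : Nat.Primes => eulerFactor N (2 * m) a p s) (LSeries a s))
    {p : ℕ} (hpp : p.Prime) (hpN : ¬ p ∣ N) :
    intSlash m !![(p : ℤ), 0; 0, 1] (qForm a) +
      ∑ b ∈ Finset.range p, intSlash m !![1, (b : ℤ); 0, (p : ℤ)] (qForm a) =
      ((p : ℂ) / p ^ m * a p) • qForm a := by
  have hp0 : (p : ℂ) ≠ 0 := by exact_mod_cast hpp.ne_zero
  have ha0 := hp.coeff_zero
  have h1 : ∀ n, a (p * n) = a p * a n - (p : ℂ) ^ (2 * m - 1) *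
      if p ∣ n then a (n / p) else 0 := by
    intro n
    rcases eq_or_ne n 0 with rfl | hn
    · simp [ha0]
    · rw [coeff_prime_mul hm ha heuler hpp hn, linCoeff, sqCoeff, if_pos hpN, if_pos hpN]
  have h2 : ∀ z : ℍ, qSeries (fun n => a (p * n)) z = a p * qSeries a z - (p : ℂ) ^ (2 * m - 1) *
      qSeries (fun n => if p ∣ n then a (n / p) else 0) z := by
    intro z
    refine ((hp.comp_mul p).hasSum z.2).unique ?_
    refine (((hp.hasSum z.2).mul_left (a p)).sub
      (((hp.dvd_ite p).hasSum z.2).mul_left ((p : ℂ) ^ (2 * m - 1)))).congr_fun fun n => ?_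
    rw [h1]
    ring
  rw [hp.sum_intSlash m hpp.ne_zero, intSlash_scale_qForm m a hpp.ne_zero]
  ext z
  simp only [Pi.add_apply, Pi.smul_apply, smul_eq_mul, qForm]
  rw [h2]
  have : (p : ℂ) / p ^ m * p ^ (2 * m - 1) = p ^ m := by
    rw [div_mul_eq_mul_div, ← pow_succ', show 2 * m - 1 + 1 = m + m by omega, pow_add]
    field_simp
  linear_combination -(qSeries (fun n => if p ∣ n then a (n / p) else 0) z) * this

lemma coeff_mul_eq_of_dvd (ha0 : a 0 = 0) (hm : 0 < m)
    (ha : a =O[Filter.atTop] fun n : ℕ => (n : ℝ) ^ σ)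
    (heuler : ∀ s : ℂ, σ + 1 < s.re →
      HasProd (fun p : Nat.Primes => eulerFactor N (2 * m) a p s) (LSeries a s))
    {p : ℕ} (hp : p.Prime) (hpN : p ∣ N) (n : ℕ) :
    a (p * n) = (if p ^ 2 ∣ N then 0 else (p : ℂ) ^ (m - 1)) * a n := by
  rcases eq_or_ne n 0 with rfl | hn
  · simp [ha0]
  · rw [coeff_prime_mul hm ha heuler hp hn, linCoeff, sqCoeff, if_neg (not_not.mpr hpN),
      if_neg (not_not.mpr hpN), zero_mul, sub_zero]
    split_ifs <;> rfl

/-- At a prime exactly dividing the level, the operator `U_p` fixes the form. -/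
lemma PolyGrowth.sum_intSlash_eq_self (hp : PolyGrowth a) (hm : 0 < m)
    (ha : a =O[Filter.atTop] fun n : ℕ => (n : ℝ) ^ σ)
    (heuler : ∀ s : ℂ, σ + 1 < s.re →
      HasProd (fun p : Nat.Primes => eulerFactor N (2 * m) a p s) (LSeries a s))
    {p : ℕ} (hpp : p.Prime) (hpN : p ∣ N) (hpN2 : ¬ p ^ 2 ∣ N) :
    ∑ b ∈ Finset.range p, intSlash m !![1, (b : ℤ); 0, (p : ℤ)] (qForm a) = qForm a := by
  have hp0 : (p : ℂ) ≠ 0 := by exact_mod_cast hpp.ne_zero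
  have ha0 := hp.coeff_zero
  rw [hp.sum_intSlash m hpp.ne_zero]
  ext z
  simp only [Pi.smul_apply, smul_eq_mul, qForm, qSeries,
    coeff_mul_eq_of_dvd ha0 hm ha heuler hpp hpN, if_neg hpN2]
  simp_rw [mul_assoc]
  rw [tsum_mul_left, ← mul_assoc, div_mul_eq_mul_div, ← pow_succ', Nat.sub_add_cancel hm,
    div_self (pow_ne_zero m hp0), one_mul]

end

section

open Complex MeasureTheory Filter Topology

/-! ### Vertical integrals -/

lemma integrable_vertical {G : ℂ → ℂ} (hG : Differentiable ℂ G) {γ C : ℝ}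
    (hC : ∀ s : ℂ, s.re = γ → ‖G s‖ ≤ C * (1 + s.im ^ 2)⁻¹) :
    Integrable fun t : ℝ => G (γ + t * I) := by
  have hc : Continuous G := hG.continuous
  refine (integrable_inv_one_add_sq.const_mul C).mono'
    (by fun_prop : Continuous fun t : ℝ => G (γ + t * I)).aestronglyMeasurable
    (.of_forall fun t => ?_)
  simpa using hC (γ + t * I) (by simp)

/-- Integrals along vertical lines of a function which is `O(1 / (1 + Im(s)²))` in the strip between
them agree. -/
lemma integral_vertical_eq {G : ℂ → ℂ} (hG : Differentiable ℂ G) {α β C : ℝ} (hαβ : α ≤ β)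
    (hC : ∀ s : ℂ, α ≤ s.re → s.re ≤ β → ‖G s‖ ≤ C * (1 + s.im ^ 2)⁻¹) :
    ∫ t : ℝ, G (α + t * I) = ∫ t : ℝ, G (β + t * I) := by
  have hi : ∀ γ : ℝ, α ≤ γ → γ ≤ β → Integrable fun t : ℝ => G (γ + t * I) :=
    fun γ h1 h2 => integrable_vertical hG fun s hs => hC s (hs ▸ h1) (hs ▸ h2)
  have hlim : ∀ γ : ℝ, α ≤ γ → γ ≤ β → Tendsto (fun T : ℝ => ∫ t in (-T)..T, G (γ + t * I)) atTop
      (𝓝 (∫ t : ℝ, G (γ + t * I))) := fun γ h1 h2 =>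
    intervalIntegral_tendsto_integral (hi γ h1 h2) tendsto_neg_atTop_atBot tendsto_id
  have hrect : ∀ T : ℝ, I • ((∫ t in (-T)..T, G (β + t * I)) - ∫ t in (-T)..T, G (α + t * I)) =
      (∫ x in α..β, G (x + T * I)) - ∫ x in α..β, G (x + (-T : ℝ) * I) := by
    intro T
    have := Complex.integral_boundary_rect_eq_zero_of_differentiableOn G (α + (-T : ℝ) * I)
      (β + T * I) hG.differentiableOn
    simp only [add_re, ofReal_re, mul_re, I_re, mul_zero, ofReal_im, I_im, mul_one, sub_self,
      add_zero, add_im, mul_im, zero_add] at this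
    rw [smul_sub]
    linear_combination this
  have hhor : ∀ T : ℝ, ‖∫ x in α..β, G (x + T * I)‖ ≤ C * (1 + T ^ 2)⁻¹ * |β - α| := by
    intro T
    refine intervalIntegral.norm_integral_le_of_norm_le_const fun x hx => ?_
    rw [Set.uIoc_of_le hαβ] at hx
    simpa using hC (x + T * I) (by simpa using hx.1.le) (by simpa using hx.2)
  have hz : Tendsto (fun T : ℝ => C * (1 + T ^ 2)⁻¹ * |β - α|) atTop (𝓝 0) := by
    have : Tendsto (fun T : ℝ => (1 + T ^ 2)⁻¹) atTop (𝓝 0) :=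
      (tendsto_atTop_add_const_left _ _ (tendsto_pow_atTop two_ne_zero)).inv_tendsto_atTop
    simpa using (this.const_mul C).mul_const |β - α|
  have h1 : Tendsto (fun T : ℝ => (∫ x in α..β, G (x + T * I)) -
      ∫ x in α..β, G (x + (-T : ℝ) * I)) atTop (𝓝 (0 - 0)) :=
    (squeeze_zero_norm hhor hz).sub (squeeze_zero_norm (fun T => by simpa using hhor (-T)) hz)
  have h2 := (((hlim β hαβ le_rfl).sub (hlim α le_rfl hαβ)).const_smul I)
  simp only [hrect] at h2
  have h3 := tendsto_nhds_unique h2 h1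
  rw [sub_self, smul_eq_zero, sub_eq_zero] at h3
  exact (h3.resolve_left I_ne_zero).symm

/-- Bounds for `s² Λ(s)` on two vertical lines propagate to the strip between them, when `Λ` is
bounded in the strip. -/
lemma norm_le_of_vertical_lines {Λ : ℂ → ℂ} (hΛ : Differentiable ℂ Λ) {α β C₀ C : ℝ} (hαβ : α < β)
    (hC₀ : ∀ s : ℂ, α ≤ s.re → s.re ≤ β → ‖Λ s‖ ≤ C₀)
    (hα : ∀ s : ℂ, s.re = α → ‖s ^ 2 * Λ s‖ ≤ C) (hβ : ∀ s : ℂ, s.re = β → ‖s ^ 2 * Λ s‖ ≤ C)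
    {s : ℂ} (h1 : α ≤ s.re) (h2 : s.re ≤ β) : ‖Λ s‖ ≤ (C₀ + C) * (1 + s.im ^ 2)⁻¹ := by
  have key : ‖s ^ 2 * Λ s‖ ≤ C := by
    refine PhragmenLindelof.vertical_strip (f := fun s => s ^ 2 * Λ s) (a := α) (b := β)
      (by fun_prop : Differentiable ℂ fun s => s ^ 2 * Λ s).diffContOnCl ?_ hα hβ h1 h2
    have hd : 0 < Real.pi / (β - α) := div_pos Real.pi_pos (sub_pos.mpr hαβ)
    set c := Real.pi / (β - α) / 2 with hc
    have hc0 : 0 < c := half_pos hd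
    refine ⟨c, half_lt_self hd, 1, ?_⟩
    set K := |α| + |β|
    refine Asymptotics.IsBigO.of_bound ((K ^ 2 + 1) * C₀ * (2 / c ^ 2)) ?_
    rw [eventually_inf_principal]
    have : ∀ᶠ z : ℂ in comap (_root_.abs ∘ im) atTop, 1 ≤ |z.im| :=
      tendsto_comap.eventually (eventually_ge_atTop (1 : ℝ))
    filter_upwards [this] with z hz hz'
    have hC := hC₀ z hz'.1.le hz'.2.le
    have hre : |z.re| ≤ K := by
      have := hz'.1; have := hz'.2
      have := neg_abs_le α; have := le_abs_self β
      have := abs_nonneg α; have := abs_nonneg β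
      exact abs_le.mpr ⟨by linarith, by linarith⟩
    have hsq : ‖z‖ ^ 2 ≤ (K ^ 2 + 1) * |z.im| ^ 2 := by
      rw [← normSq_eq_norm_sq, normSq_apply, ← sq, ← sq, ← sq_abs z.re, ← sq_abs z.im]
      have : |z.re| ^ 2 ≤ K ^ 2 := by gcongr
      nlinarith [sq_nonneg K, one_le_pow₀ hz (n := 2)]
    have hexp : |z.im| ^ 2 ≤ 2 / c ^ 2 * Real.exp (1 * Real.exp (c * |z.im|)) := by
      have e1 := Real.pow_div_factorial_le_exp (c * |z.im|) (by positivity) 2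
      have e2 : Real.exp (c * |z.im|) ≤ Real.exp (1 * Real.exp (c * |z.im|)) := by
        rw [one_mul]
        exact Real.exp_le_exp.mpr ((le_add_of_nonneg_right zero_le_one).trans
          (Real.add_one_le_exp _))
      have e3 := e1.trans e2
      rw [div_mul_eq_mul_div, le_div_iff₀ (by positivity)]
      norm_num [Nat.factorial] at e3
      nlinarith
    rw [norm_mul, norm_pow, Real.norm_of_nonneg (Real.exp_pos _).le]
    have hC₀' : 0 ≤ C₀ := (norm_nonneg _).trans hC
    calc _ ≤ (K ^ 2 + 1) * |z.im| ^ 2 * C₀ := by gcongr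
      _ ≤ (K ^ 2 + 1) * (2 / c ^ 2 * Real.exp (1 * Real.exp (c * |z.im|))) * C₀ := by gcongr
      _ = _ := by ring
  rw [← div_eq_mul_inv, le_div_iff₀ (by positivity)]
  rw [norm_mul, norm_pow] at key
  have h3 : s.im ^ 2 ≤ ‖s‖ ^ 2 := by
    rw [← sq_abs]
    exact pow_le_pow_left₀ (abs_nonneg _) (abs_im_le_norm s) 2
  nlinarith [hC₀ s h1 h2, mul_le_mul_of_nonneg_right h3 (norm_nonneg (Λ s))]

lemma norm_Gamma_le {s : ℂ} (hs : 0 < s.re) : ‖Gamma s‖ ≤ Real.Gamma s.re := by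
  rw [Gamma_eq_integral hs, GammaIntegral, Real.Gamma_eq_integral hs]
  refine (norm_integral_le_integral_norm _).trans (le_of_eq ?_)
  refine setIntegral_congr_fun measurableSet_Ioi fun x hx => ?_
  rw [norm_mul, norm_real, Real.norm_of_nonneg (Real.exp_pos _).le,
    norm_cpow_eq_rpow_re_of_pos hx, sub_re, one_re]

lemma norm_sq_mul_Gamma_le {s : ℂ} (hs : 0 < s.re) :
    ‖s ^ 2 * Gamma s‖ ≤ Real.Gamma (s.re + 2) := by
  have h0 : s ≠ 0 := fun h => by simp [h] at hs
  have h1 : s + 1 ≠ 0 := fun h => by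
    have := congrArg re h
    simp at this
    linarith
  have h2 := norm_Gamma_le (s := s + 1 + 1) (by simp; linarith)
  rw [Gamma_add_one _ h1, Gamma_add_one _ h0] at h2
  have h3 : ‖s‖ ≤ ‖s + 1‖ := by
    rw [norm_def, norm_def]
    refine Real.sqrt_le_sqrt ?_
    simp only [normSq_apply, add_re, one_re, add_im, one_im, add_zero]
    nlinarith
  calc ‖s ^ 2 * Gamma s‖ = ‖s‖ * ‖s * Gamma s‖ := by simp; ring
    _ ≤ ‖s + 1‖ * ‖s * Gamma s‖ := by gcongr
    _ = ‖(s + 1) * (s * Gamma s)‖ := (norm_mul _ _).symm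
    _ ≤ _ := h2.trans (le_of_eq (by simp; ring_nf))

end

section

open UpperHalfPlane hiding I
open Complex MeasureTheory Filter Topology

/-! ### From the functional equation to the Fricke involution -/

lemma gammaC_mul_term (a : ℕ → ℂ) (ha0 : a 0 = 0) (s : ℂ) (n : ℕ) :
    Gamma s * a n / ((2 * Real.pi * n : ℝ) : ℂ) ^ s = gammaC s * LSeries.term a s n := by
  rcases eq_or_ne n 0 with rfl | hn
  · simp [ha0]
  have h2 : (2 * Real.pi : ℂ) = ((2 * Real.pi : ℝ) : ℂ) := by push_cast; rfl
  rw [LSeries.term_of_ne_zero hn, gammaC, ofReal_mul, mul_cpow_ofReal_nonneg (by positivity)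
    (by positivity), cpow_neg, ← h2, ofReal_natCast]
  field_simp

variable {a : ℕ → ℂ} {σ : ℝ}

lemma PolyGrowth.continuousOn_qSeries_mul_I (hp : PolyGrowth a) :
    ContinuousOn (fun y : ℝ => qSeries a (y * I)) (Set.Ioi 0) :=
  hp.differentiableOn.continuousOn.comp (by fun_prop) fun y hy => by simpa using hy

/-- The completed Dirichlet series is the Mellin transform of the `q`-series on the imaginary
axis. -/
lemma PolyGrowth.exists_mellin_eq (hp : PolyGrowth a)
    (ha : a =O[Filter.atTop] fun n : ℕ => (n : ℝ) ^ σ) :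
    ∃ c₀ : ℝ, ∀ s : ℂ, c₀ < s.re → LSeriesSummable a s ∧
      MellinConvergent (fun y : ℝ => qSeries a (y * I)) s ∧
      mellin (fun y : ℝ => qSeries a (y * I)) s = gammaC s * LSeries a s := by
  obtain ⟨B₀, hB⟩ := hp.exists_norm_qSeries_le
  refine ⟨max (σ + 1) B₀, fun s hs => ?_⟩
  obtain ⟨hs1, hs2⟩ := max_lt_iff.mp hs
  have hs0 : 0 < s.re := (Nat.cast_nonneg B₀).trans_lt hs2
  have hsum : LSeriesSummable a s := LSeriesSummable_of_isBigO_rpow hs1 (by simpa using ha)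
  refine ⟨hsum, ?_, ?_⟩
  · have bound : ∀ B ≥ B₀, ∃ K : ℝ, ∀ y : ℝ, 0 < y → ‖qSeries a (y * I)‖ ≤
        K * ‖y ^ (-(B : ℝ))‖ := by
      intro B h
      obtain ⟨K, hK⟩ := hB B h
      refine ⟨K, fun y hy => (hK (y * I) (by simpa)).trans (le_of_eq ?_)⟩
      rw [Real.rpow_neg hy.le, Real.rpow_natCast, Real.norm_of_nonneg (by positivity)]
      simp [div_eq_mul_inv]
    obtain ⟨K₀, h0⟩ := bound B₀ le_rfl
    obtain ⟨K₁, h1⟩ := bound (max B₀ (⌈s.re⌉₊ + 1)) (le_max_left _ _)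
    refine mellinConvergent_of_isBigO_rpow (a := (max B₀ (⌈s.re⌉₊ + 1) : ℕ)) (b := B₀)
      (hp.continuousOn_qSeries_mul_I.locallyIntegrableOn measurableSet_Ioi)
      (.of_bound K₁ ?_) ?_ (.of_bound K₀ ?_) hs2
    · filter_upwards [eventually_gt_atTop 0] with y hy using h1 y hy
    · have h2 : s.re < (⌈s.re⌉₊ + 1 : ℕ) := by
        push_cast
        exact (Nat.le_ceil _).trans_lt (lt_add_one _)
      exact h2.trans_le (by exact_mod_cast le_max_right _ _)
    · filter_upwards [self_mem_nhdsWithin] with y hy using h0 y hy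
  · have h1 := hasSum_mellin (a := a) (p := fun n : ℕ => 2 * Real.pi * n) (s := s)
      (F := fun y : ℝ => qSeries a (y * I)) (fun n => ?_) hs0 (fun y hy => ?_) ?_
    · refine h1.unique ?_
      simp_rw [gammaC_mul_term a hp.coeff_zero s]
      exact hsum.LSeriesHasSum.mul_left _
    · rcases n.eq_zero_or_pos with rfl | hn
      · exact .inl hp.coeff_zero
      · exact .inr (by positivity)
    · refine (hp.hasSum (w := y * I) (by simpa using hy)).congr_fun fun n => ?_
      congr 1
      rw [ofReal_exp]
      congr 1
      push_cast
      linear_combination (-2 * Real.pi * n * y : ℂ) * I_sq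
    · refine (hsum.norm.mul_left ((2 * Real.pi) ^ s.re)⁻¹).congr fun n => ?_
      rw [LSeries.norm_term_eq,
        Real.mul_rpow (by positivity : 0 ≤ 2 * Real.pi) (Nat.cast_nonneg n)]
      split_ifs with hn
      · simp [hn, hp.coeff_zero]
      · field_simp

/-- The decay of the completed Dirichlet series on a vertical line far to the right. -/
lemma exists_norm_sq_mul_le {c : ℝ} (hc : 0 < c) (hsum : LSeriesSummable a c) :
    ∃ C : ℝ, ∀ s : ℂ, s.re = c → ‖s ^ 2 * (gammaC s * LSeries a s)‖ ≤ C := by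
  refine ⟨(2 * Real.pi) ^ (-c) * Real.Gamma (c + 2) * ∑' n, ‖LSeries.term a c n‖, fun s hs => ?_⟩
  have h1 : ‖LSeries a s‖ ≤ ∑' n, ‖LSeries.term a c n‖ := by
    refine tsum_of_norm_bounded hsum.norm.hasSum fun n => le_of_eq ?_
    simp [LSeries.norm_term_eq, hs]
  have h2 := norm_sq_mul_Gamma_le (hs ▸ hc)
  have h3 : ‖(2 * Real.pi : ℂ) ^ (-s)‖ = (2 * Real.pi) ^ (-c) := by
    rw [show (2 * Real.pi : ℂ) = ((2 * Real.pi : ℝ) : ℂ) by push_cast; rfl,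
      norm_cpow_eq_rpow_re_of_pos (by positivity), neg_re, hs]
  rw [hs] at h2
  have hG : 0 ≤ Real.Gamma (c + 2) := (Real.Gamma_pos_of_pos (by linarith)).le
  calc _ = ‖(2 * Real.pi : ℂ) ^ (-s)‖ * ‖s ^ 2 * Gamma s‖ * ‖LSeries a s‖ := by
        simp only [gammaC, norm_mul]; ring
    _ ≤ _ := by rw [h3]; gcongr

/-- Two holomorphic functions on the upper half-plane that agree on the imaginary axis agree. -/
lemma Holo.eq_of_imaginary_axis {f g : ℍ → ℂ} (hf : Holo f) (hg : Holo g)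
    (h : ∀ y : ℝ, ∀ hy : 0 < y, f ⟨y * I, by simpa⟩ = g ⟨y * I, by simpa⟩) : f = g := by
  have ho : IsOpen {z : ℂ | 0 < z.im} := isOpen_lt continuous_const continuous_im
  have hU : IsPreconnected {z : ℂ | 0 < z.im} := (convex_halfSpace_im_gt 0).isPreconnected
  have key := (hf.analyticOnNhd ho).eqOn_of_preconnected_of_frequently_eq (z₀ := I)
    (hg.analyticOnNhd ho) hU (by simp) ?_
  · ext z
    simpa [ofComplex_apply] using key z.2
  · have h1 : Tendsto (fun y : ℝ => (y : ℂ) * I) (𝓝[≠] 1) (𝓝[≠] I) := by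
      refine tendsto_nhdsWithin_iff.mpr ⟨?_, ?_⟩
      · have : Tendsto (fun y : ℝ => (y : ℂ) * I) (𝓝 1) (𝓝 ((1 : ℝ) * I)) :=
          (by fun_prop : Continuous fun y : ℝ => (y : ℂ) * I).tendsto 1
        rw [ofReal_one, one_mul] at this
        exact this.mono_left nhdsWithin_le_nhds
      · filter_upwards [self_mem_nhdsWithin] with y hy h0
        have := congrArg Complex.im h0
        simp at this
        exact hy this
    refine h1.frequently (Eventually.frequently ?_)
    filter_upwards [nhdsWithin_le_nhds (Ioi_mem_nhds (zero_lt_one (α := ℝ)))] with y hy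
    have hy' : 0 < ((y : ℂ) * I).im := by simpa using hy
    rw [Function.comp_apply, Function.comp_apply, ofComplex_apply_of_im_pos hy']
    exact h y hy

/-- Hecke's converse theorem for the Fricke involution, on the imaginary axis. -/
lemma PolyGrowth.qSeries_mul_I_eq {N m : ℕ} (hN : 0 < N) (hp : PolyGrowth a)
    (ha : a =O[Filter.atTop] fun n : ℕ => (n : ℝ) ^ σ) {Λ : ℂ → ℂ}
    (hΛ : ∀ s : ℂ, σ + 1 < s.re → Λ s = gammaC s * LSeries a s) (hEBV : IsEBV Λ)
    (hFE : ∀ s : ℂ, Λ s = (-1 : ℂ) ^ m * (N : ℂ) ^ ((m : ℂ) - s) * Λ ((2 * m : ℂ) - s))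
    {x : ℝ} (hx : 0 < x) :
    qSeries a (x * I) = (-1 : ℂ) ^ m / ((N : ℂ) ^ m * (x : ℂ) ^ (2 * m)) *
      qSeries a ((1 / (N * x) : ℝ) * I) := by
  obtain ⟨c₀, h0⟩ := hp.exists_mellin_eq ha
  obtain ⟨c, hc⟩ : ∃ c : ℝ, max (max c₀ (σ + 1)) (max 0 (m : ℝ)) < c := exists_gt _
  obtain ⟨⟨hc0, hcσ⟩, hcpos, hcm⟩ : (c₀ < c ∧ σ + 1 < c) ∧ 0 < c ∧ (m : ℝ) < c := by
    simpa only [max_lt_iff] using hc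
  have hN' : (0 : ℝ) < N := by exact_mod_cast hN
  obtain ⟨C₀, hC₀⟩ := hEBV.2 (2 * m - c) c
  obtain ⟨C₁, hC₁⟩ := exists_norm_sq_mul_le hcpos (h0 c (by simpa)).1
  have hC₁' : ∀ s : ℂ, s.re = c → ‖s ^ 2 * Λ s‖ ≤ C₁ := fun s hs => by
    rw [hΛ s (hs ▸ hcσ)]
    exact hC₁ s hs
  -- the functional equation carries the bound to the reflected line `Re s = 2m - c`
  have hleft : ∀ s : ℂ, s.re = 2 * m - c →
      ‖s ^ 2 * Λ s‖ ≤ (1 + 2 * m / c) ^ 2 * (N : ℝ) ^ (c - m) * C₁ := by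
    intro s hs
    have hre : (2 * m - s : ℂ).re = c := by
      simp [hs]
    have h1 := hC₁' _ hre
    have h2 : c ≤ ‖(2 * m - s : ℂ)‖ := hre ▸ re_le_norm _
    have h3 : ‖s‖ ≤ (1 + 2 * m / c) * ‖(2 * m - s : ℂ)‖ := by
      have h4 : ‖s‖ ≤ 2 * m + ‖(2 * m - s : ℂ)‖ := by
        have := norm_sub_le (2 * m : ℂ) (2 * m - s)
        simpa using this
      have h5 : (2 * m : ℝ) ≤ 2 * m / c * ‖(2 * m - s : ℂ)‖ := by
        rw [div_mul_eq_mul_div, le_div_iff₀ hcpos]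
        gcongr
      linarith
    have h6 : ‖(N : ℂ) ^ ((m : ℂ) - s)‖ = (N : ℝ) ^ (c - m) := by
      rw [norm_natCast_cpow_of_pos hN]
      congr 1
      simp [hs]
      ring
    rw [hFE s, norm_mul, norm_pow]
    rw [norm_mul, norm_pow] at h1
    have h7 : ‖(-1 : ℂ) ^ m * (N : ℂ) ^ ((m : ℂ) - s) * Λ (2 * m - s)‖ =
        (N : ℝ) ^ (c - m) * ‖Λ (2 * m - s)‖ := by
      simp [h6]
    rw [h7]
    calc _ ≤ ((1 + 2 * m / c) * ‖(2 * m - s : ℂ)‖) ^ 2 *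
          ((N : ℝ) ^ (c - m) * ‖Λ (2 * m - s)‖) := by gcongr
      _ = (1 + 2 * m / c) ^ 2 * (N : ℝ) ^ (c - m) *
          (‖(2 * m - s : ℂ)‖ ^ 2 * ‖Λ (2 * m - s)‖) := by ring
      _ ≤ _ := by gcongr
  have hstrip : 2 * m - c < c := by linarith
  obtain ⟨C, hC⟩ : ∃ C : ℝ, ∀ s : ℂ, 2 * m - c ≤ s.re → s.re ≤ c →
      ‖Λ s‖ ≤ C * (1 + s.im ^ 2)⁻¹ :=
    ⟨_, fun s h1 h2 => norm_le_of_vertical_lines hEBV.1 hstrip hC₀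
      (fun s hs => (hleft s hs).trans (le_max_right C₁ _))
      (fun s hs => (hC₁' s hs).trans (le_max_left _ _)) h1 h2⟩
  have hinv : ∀ x : ℝ, 0 < x → qSeries a (x * I) =
      (1 / (2 * Real.pi)) • ∫ t : ℝ, (x : ℂ) ^ (-(c + t * I)) * Λ (c + t * I) := by
    intro x hx
    have hm : ∀ t : ℝ, mellin (fun y : ℝ => qSeries a (y * I)) (c + t * I) = Λ (c + t * I) := by
      intro t
      rw [(h0 (c + t * I) (by simpa)).2.2, hΛ _ (by simpa)]
    have := mellinInv_mellin_eq c (fun y : ℝ => qSeries a (y * I)) hx (h0 c (by simpa)).2.1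
      (by
        simp only [VerticalIntegrable, hm]
        exact integrable_vertical hEBV.1 fun s hs => hC s (hs ▸ hstrip.le) hs.le)
      (hp.continuousOn_qSeries_mul_I.continuousAt (Ioi_mem_nhds hx))
    rw [← this]
    simp only [mellinInv, hm, smul_eq_mul]
  have hxc : (x : ℂ) ≠ 0 := ofReal_ne_zero.mpr hx.ne'
  have hNc : (N : ℂ) ≠ 0 := by exact_mod_cast hN.ne'
  -- the contour shift in the inversion formula
  have hshift : ∫ t : ℝ, (x : ℂ) ^ (-(((2 * m - c : ℝ) : ℂ) + t * I)) *
      Λ (((2 * m - c : ℝ) : ℂ) + t * I) = ∫ t : ℝ, (x : ℂ) ^ (-(c + t * I)) * Λ (c + t * I) := by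
    have hd : Differentiable ℂ fun s : ℂ => (x : ℂ) ^ (-s) * Λ s :=
      (differentiable_id.neg.const_cpow (.inl hxc)).mul hEBV.1
    refine integral_vertical_eq hd (C := (x ^ (-c) + x ^ (-(2 * m - c))) * C) hstrip.le
      fun s h1 h2 => ?_
    rw [norm_mul, norm_cpow_eq_rpow_re_of_pos hx, neg_re, mul_assoc]
    have h3 : x ^ (-s.re) ≤ x ^ (-c) + x ^ (-(2 * m - c)) := by
      rcases le_total 1 x with h | h
      · exact (Real.rpow_le_rpow_of_exponent_le h (neg_le_neg h1)).trans
          (le_add_of_nonneg_left (by positivity))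
      · exact (Real.rpow_le_rpow_of_exponent_ge hx h (neg_le_neg h2)).trans
          (le_add_of_nonneg_right (by positivity))
    gcongr
    exact hC s h1 h2
  -- the functional equation turns the integrand at `2m - u` for `x` into the one at `u` for
  -- `1 / (N * x)`
  have hpt : ∀ u : ℂ, (x : ℂ) ^ (-(2 * m - u)) * Λ (2 * m - u) =
      (-1 : ℂ) ^ m / ((N : ℂ) ^ m * (x : ℂ) ^ (2 * m)) *
        (((1 / (N * x) : ℝ) : ℂ) ^ (-u) * Λ u) := by
    intro u
    have e1 : (x : ℂ) ^ (-(2 * m - u)) = (x : ℂ) ^ u / (x : ℂ) ^ (2 * m) := by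
      rw [neg_sub, cpow_sub _ _ hxc, ← cpow_natCast]
      push_cast
      rfl
    have e2 : (N : ℂ) ^ ((m : ℂ) - (2 * m - u)) = (N : ℂ) ^ u / (N : ℂ) ^ m := by
      rw [show (m : ℂ) - (2 * m - u) = u - m by ring, cpow_sub _ _ hNc, cpow_natCast]
    have e3 : ((1 / (N * x) : ℝ) : ℂ) ^ (-u) = (N : ℂ) ^ u * (x : ℂ) ^ u := by
      rw [one_div, ofReal_inv, inv_cpow _ _ (by
        rw [arg_ofReal_of_nonneg (by positivity)]; exact Real.pi_pos.ne), cpow_neg, inv_inv,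
        ofReal_mul, mul_cpow_ofReal_nonneg hN'.le hx.le, ofReal_natCast]
    rw [hFE, e1, e2, e3, show (2 * m : ℂ) - (2 * m - u) = u by ring]
    field_simp
  rw [hinv x hx, hinv _ (by positivity), ← hshift, mul_smul_comm, ← integral_const_mul,
    ← integral_neg_eq_self]
  congr 2
  ext t
  rw [← hpt]
  push_cast
  ring_nf

end

section

open UpperHalfPlane hiding I
open Complex Filter Topology Function.Periodic
open scoped ModularForm

variable {a : ℕ → ℂ} {σ : ℝ}

/-- Hecke's converse theorem: the functional equation gives invariance under the Fricke matrix. -/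
theorem PolyGrowth.intSlash_fricke {N m : ℕ} (hN : 0 < N) (hp : PolyGrowth a)
    (ha : a =O[Filter.atTop] fun n : ℕ => (n : ℝ) ^ σ) {Λ : ℂ → ℂ}
    (hΛ : ∀ s : ℂ, σ + 1 < s.re → Λ s = gammaC s * LSeries a s) (hEBV : IsEBV Λ)
    (hFE : ∀ s : ℂ, Λ s = (-1 : ℂ) ^ m * (N : ℂ) ^ ((m : ℂ) - s) * Λ ((2 * m : ℂ) - s)) :
    intSlash m !![0, -1; (N : ℤ), 0] (qForm a) = qForm a := by
  have hd : 0 < (!![0, -1; (N : ℤ), 0] : Matrix (Fin 2) (Fin 2) ℤ).det := by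
    rw [Matrix.det_fin_two_of]; omega
  have hNc : (N : ℂ) ≠ 0 := by exact_mod_cast hN.ne'
  refine (hp.holo.intSlash m hd).eq_of_imaginary_axis hp.holo fun y hy => ?_
  have hyc : (y : ℂ) ≠ 0 := ofReal_ne_zero.mpr hy.ne'
  rw [intSlash_qForm m hd, qForm, hp.qSeries_mul_I_eq hN ha hΛ hEBV hFE hy]
  congr 1
  · have : (I : ℂ) ^ (2 * m) = (-1) ^ m := by rw [pow_mul, I_sq]
    simp only [Matrix.det_fin_two_of, mul_zero, Matrix.of_apply, Matrix.cons_val',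
      Matrix.cons_val_zero,
      Matrix.cons_val_one, Matrix.cons_val_fin_one]
    push_cast
    have h1 : ((-1 : ℂ) ^ m) * (-1) ^ m = 1 := by rw [← mul_pow]; simp
    rw [add_zero, mul_pow, mul_pow, this, show 2 * m = m + m by ring, pow_add (N : ℂ)]
    field_simp
    linear_combination -(N : ℂ) ^ m * h1
  · congr 1
    simp
    field_simp
    simp

/-! ### Behaviour at the cusps -/

/-- A holomorphic periodic function of polynomial growth at `i∞` is bounded there, because as a
function of `q` it has a removable singularity. -/
lemma Holo.isBoundedAtImInfty {g : ℍ → ℂ} (hg : Holo g) {h : ℝ} (hh : 0 < h)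
    (hper : Function.Periodic (g ∘ ofComplex) h) {K : ℝ} {B : ℕ}
    (hgr : ∀ z : ℍ, |z.re| ≤ h → 1 ≤ z.im → ‖g z‖ ≤ K * z.im ^ B) : IsBoundedAtImInfty g := by
  set F := cuspFunction h (g ∘ ofComplex) with hF
  have him : Tendsto (fun q => (invQParam h q).im) (𝓝[≠] 0) atTop :=
    tendsto_comap_iff.mp (invQParam_tendsto hh)
  have hd : ∀ᶠ q in 𝓝[≠] 0, DifferentiableAt ℂ F q := by
    refine eventually_differentiableAt_cuspFunction_nhds_ne_zero hh hper ?_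
    filter_upwards [tendsto_comap.eventually (eventually_gt_atTop (0 : ℝ))] with w hw
    exact (hg w hw).differentiableAt
      ((isOpen_lt continuous_const Complex.continuous_im).mem_nhds hw)
  have hO : F =O[𝓝[≠] 0] fun q => (invQParam h q).im ^ B := by
    refine .of_bound K ?_
    filter_upwards [him.eventually (eventually_ge_atTop 1), self_mem_nhdsWithin] with q hq hq0
    have hq' : 0 < (invQParam h q).im := by linarith
    rw [hF, cuspFunction_eq_of_nonzero _ _ hq0, Function.comp_apply,
      ofComplex_apply_of_im_pos hq', Real.norm_of_nonneg (by positivity)]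
    refine hgr ⟨_, hq'⟩ ?_ hq
    -- the logarithm is the principal one, so real parts stay bounded
    have hre : (invQParam h q).re = h * (arg q / (2 * Real.pi)) := by
      have : invQParam h q = ((h / (2 * Real.pi) : ℝ) : ℂ) * (log q * -I) := by
        rw [invQParam, mul_comm (2 * (Real.pi : ℂ)), div_mul_eq_div_div, div_I]
        push_cast
        ring
      rw [this, re_ofReal_mul]
      simp [log_im]
      ring
    change |(invQParam h q).re| ≤ h
    rw [hre, abs_mul, abs_of_pos hh, abs_div, abs_of_pos Real.two_pi_pos]
    refine mul_le_of_le_one_right hh.le ((div_le_one Real.two_pi_pos).mpr ?_)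
    linarith [abs_arg_le_pi q, Real.pi_pos]
  have ho : (fun q => (invQParam h q).im ^ B) =o[𝓝[≠] 0] fun q : ℂ => q⁻¹ := by
    refine (((isLittleO_pow_exp_pos_mul_atTop B (b := 2 * Real.pi / h) (by positivity)).comp_tendsto
      him).congr' .rfl ?_).of_norm_right
    filter_upwards [self_mem_nhdsWithin] with q hq
    have hq0 : 0 < ‖q‖ := norm_pos_iff.mpr hq
    rw [Function.comp_apply, im_invQParam, norm_inv, ← Real.exp_log hq0, ← Real.exp_neg,
      Real.exp_log hq0]
    congr 1
    field_simp
  have hc : (fun _ : ℂ => F 0) =o[𝓝[≠] 0] fun q : ℂ => q⁻¹ :=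
    Asymptotics.isLittleO_const_left.mpr (.inr tendsto_norm_inv_nhdsNE_zero_atTop)
  have hlim := tendsto_limUnder_of_differentiable_on_punctured_nhds_of_isLittleO hd
    (by simpa using (hO.trans_isLittleO ho).sub hc)
  have h1 : Tendsto (fun z : ℍ => (z : ℂ)) atImInfty (comap Complex.im atTop) :=
    tendsto_comap_iff.mpr tendsto_comap
  have h2 := ((hlim.comp (qParam_tendsto hh)).comp h1).isBigO_one ℝ
  refine h2.congr_left fun z => ?_
  rw [Function.comp_apply, Function.comp_apply, hF, eq_cuspFunction hh.ne' hper,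
    Function.comp_apply, ofComplex_apply]

/-- On `SL(2, ℤ)` the action is the slash action of Mathlib in weight `2m`. -/
lemma intSlash_eq_slash (m : ℕ) (γ : SL(2, ℤ)) (f : ℍ → ℂ) :
    intSlash m (γ : Matrix (Fin 2) (Fin 2) ℤ) f = f ∣[((2 * m : ℕ) : ℤ)] γ := by
  ext z
  rw [ModularForm.SL_slash_apply, intSlash_apply, γ.2, mul_comm, Int.cast_one, one_pow, one_div,
    zpow_neg, zpow_natCast]
  congr 2
  ext
  rw [coe_ofComplex_moebius (by rw [γ.2]; exact one_pos), coe_specialLinearGroup_apply]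
  simp

lemma PolyGrowth.isBoundedAtImInfty_intSlash {N m : ℕ} (hN : 0 < N) (hp : PolyGrowth a)
    (h : ∀ γ ∈ CongruenceSubgroup.Gamma0 N, intSlash m γ (qForm a) = qForm a) (γ : SL(2, ℤ)) :
    IsBoundedAtImInfty (intSlash m (γ : Matrix (Fin 2) (Fin 2) ℤ) (qForm a)) := by
  have hdet : ∀ δ : SL(2, ℤ), 0 < (δ : Matrix (Fin 2) (Fin 2) ℤ).det := fun δ => by simp
  set g := intSlash m (γ : Matrix (Fin 2) (Fin 2) ℤ) (qForm a) with hg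
  have hN' : (1 : ℝ) ≤ N := by exact_mod_cast hN
  have hTN : ((ModularGroup.T ^ N : SL(2, ℤ)) : Matrix (Fin 2) (Fin 2) ℤ) =
      !![1, (N : ℤ); 0, 1] := by
    rw [← zpow_natCast, ModularGroup.coe_T_zpow]
  have hT : intSlash m !![1, (N : ℤ); 0, 1] g = g := by
    have h1 : γ * ModularGroup.T ^ N * γ⁻¹ ∈ CongruenceSubgroup.Gamma0 N := by
      rw [mem_Gamma0_iff_dvd]
      refine ⟨-(γ 1 0) ^ 2, ?_⟩
      simp [Matrix.mul_apply, Fin.sum_univ_two, ModularGroup.coe_T_zpow, ← zpow_natCast,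
        Matrix.adjugate_fin_two, Matrix.SpecialLinearGroup.coe_inv]
      ring
    have h2 := congrArg (intSlash m γ) (h _ h1)
    rw [intSlash_intSlash m (hdet _) (hdet _), ← Matrix.SpecialLinearGroup.coe_mul,
      inv_mul_cancel_right] at h2
    rw [← hTN, hg, intSlash_intSlash m (hdet _) (hdet _), ← Matrix.SpecialLinearGroup.coe_mul, h2]
  have hper : Function.Periodic (g ∘ ofComplex) (N : ℝ) := by
    intro w
    rcases lt_or_ge 0 w.im with hw | hw
    · have h1 := congrFun hT ⟨w, hw⟩
      rw [intSlash_apply] at h1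
      simp at h1
      rw [Function.comp_apply, Function.comp_apply, ofComplex_apply_of_im_pos hw, ← h1]
      simp
    · rw [Function.comp_apply, Function.comp_apply, ofComplex_apply_of_im_nonpos hw,
        ofComplex_apply_of_im_nonpos (by simpa using hw)]
  obtain ⟨B₀, hB⟩ := hp.exists_norm_qSeries_le
  set B := max B₀ m
  obtain ⟨K, hK⟩ := hB B (le_max_left _ _)
  have hK0 : 0 ≤ K := by simpa using (norm_nonneg _).trans (hK I (by simp))
  set M : ℝ := |(γ 1 0 : ℝ)| * (N + 1) + |(γ 1 1 : ℝ)| with hM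
  refine (hp.holo.intSlash m (hdet γ)).isBoundedAtImInfty (zero_lt_one.trans_le hN') hper
    (K := K * M ^ (2 * (B - m))) (B := 2 * (B - m)) fun z hre him => ?_
  have hD : ‖(γ 1 0 : ℂ) * z + γ 1 1‖ ≤ M * z.im := by
    have hz : ‖(z : ℂ)‖ ≤ (N + 1) * z.im := by
      have := norm_le_abs_re_add_abs_im (z : ℂ)
      rw [coe_re, coe_im, abs_of_pos z.im_pos] at this
      nlinarith
    calc _ ≤ |(γ 1 0 : ℝ)| * ‖(z : ℂ)‖ + |(γ 1 1 : ℝ)| := by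
          refine (norm_add_le _ _).trans (le_of_eq ?_)
          rw [norm_mul, norm_intCast, norm_intCast]
      _ ≤ |(γ 1 0 : ℝ)| * ((N + 1) * z.im) + |(γ 1 1 : ℝ)| * z.im := by
          gcongr
          exact le_mul_of_one_le_right (abs_nonneg _) him
      _ = _ := by ring
  have hD0 : 0 < ‖(γ 1 0 : ℂ) * z + γ 1 1‖ :=
    norm_pos_iff.mpr (denom_ne_zero_of_det_pos (hdet γ) z.2)
  have him0 := z.im_pos
  have hq := hK _ (im_moebius_pos (hdet γ) z.2)
  rw [im_moebius (hdet γ) z.2, γ.2, normSq_eq_norm_sq, Int.cast_one, one_mul, coe_im] at hq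
  rw [intSlash_qForm m (hdet γ), norm_mul, norm_div, γ.2, norm_pow, norm_pow, Int.cast_one,
    norm_one, one_pow]
  set D := ‖(γ 1 0 : ℂ) * z + γ 1 1‖
  have hBm : 2 * B = 2 * m + 2 * (B - m) := by
    have := le_max_right B₀ m
    omega
  calc _ ≤ 1 / D ^ (2 * m) * (K / (z.im / D ^ 2) ^ B) := by gcongr
    _ = K * D ^ (2 * (B - m)) / z.im ^ B := by
      rw [div_pow, ← pow_mul, hBm, pow_add]
      field_simp
    _ ≤ K * D ^ (2 * (B - m)) := div_le_self (by positivity) (one_le_pow₀ him)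
    _ ≤ K * (M * z.im) ^ (2 * (B - m)) := by gcongr
    _ = _ := by rw [mul_pow, mul_assoc]

end

section

open UpperHalfPlane hiding I
open Complex Filter CongruenceSubgroup
open scoped ModularForm

variable {a : ℕ → ℂ} {σ : ℝ}

/-! ### The modular form -/

/-- A `q`-series fixed by `Γ₀(N)` is a modular form: it is bounded at all cusps because its
coefficients grow polynomially. -/
lemma PolyGrowth.exists_modularForm {N m : ℕ} (hN : 0 < N) (hp : PolyGrowth a)
    (h : ∀ γ ∈ Gamma0 N, intSlash m γ (qForm a) = qForm a) :
    ∃ F : ModularForm (Gamma0 N : Subgroup (GL (Fin 2) ℝ)) ((2 * m : ℕ) : ℤ),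
      ∀ z : ℍ, F z = qSeries a z := by
  have hslash : ∀ γ ∈ (Gamma0 N : Subgroup (GL (Fin 2) ℝ)),
      qForm a ∣[((2 * m : ℕ) : ℤ)] γ = qForm a := by
    rintro _ ⟨γ, hγ, rfl⟩
    exact (intSlash_eq_slash m γ (qForm a)).symm.trans (h γ hγ)
  have hcusp : ∀ {c : OnePoint ℝ}, IsCusp c (Gamma0 N : Subgroup (GL (Fin 2) ℝ)) →
      c.IsBoundedAt (qForm a) ((2 * m : ℕ) : ℤ) := by
    intro c hc
    have hc' : IsCusp c 𝒮ℒ := hc.mono (by rintro _ ⟨γ, -, rfl⟩; exact ⟨γ, rfl⟩)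
    refine (OnePoint.isBoundedAt_iff_forall_SL2Z hc').mpr fun γ _ => ?_
    exact intSlash_eq_slash m γ (qForm a) ▸ hp.isBoundedAtImInfty_intSlash hN h γ
  exact ⟨⟨⟨qForm a, hslash⟩, mdifferentiable_iff.mpr hp.holo, hcusp⟩, fun z => rfl⟩

lemma polyGrowth_of_isBigO (ha0 : a 0 = 0)
    (ha : a =O[atTop] fun n : ℕ => (n : ℝ) ^ σ) : PolyGrowth a := by
  obtain ⟨M, hM⟩ := exists_norm_le_pow ha
  refine ⟨1 + ‖a 1‖, M, fun n => ?_⟩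
  rcases n with _ | _ | n
  · simp [ha0]
  · simp
  · have h1 : (1 : ℝ) ≤ (n + 1 + 1 : ℕ) := by exact_mod_cast Nat.le_add_left 1 (n + 1)
    refine (hM _ (by omega)).trans ((pow_le_pow_right₀ h1 M.le_succ).trans ?_)
    exact le_mul_of_one_le_left (by positivity) (by linarith [norm_nonneg (a 1)])

variable {m : ℕ}

/-- Invariance under `Γ₀(N)` at the three levels. -/
theorem PolyGrowth.intSlash_eq {N : ℕ} (hN : N = 18 ∨ N = 20 ∨ N = 24) (hm : 0 < m)
    (hp : PolyGrowth a) (ha : a =O[atTop] fun n : ℕ => (n : ℝ) ^ σ)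
    (heuler : ∀ s : ℂ, σ + 1 < s.re →
      HasProd (fun p : Nat.Primes => eulerFactor N (2 * m) a p s) (LSeries a s))
    (hW : intSlash m !![0, -1; (N : ℤ), 0] (qForm a) = qForm a) :
    ∀ γ ∈ Gamma0 N, intSlash m γ (qForm a) = qForm a := by
  have hT := intSlash_translate_qForm m a
  have h2 : ∀ p : ℕ, p.Prime → p ^ 2 ∣ N → ∀ n, a (p * n) = 0 := by
    intro p hpp hpN n
    rw [coeff_mul_eq_of_dvd hp.coeff_zero hm ha heuler hpp ((dvd_pow_self p two_ne_zero).trans hpN),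
      if_pos hpN, zero_mul]
  have hhalf : 2 ^ 2 ∣ N → intSlash m !![2, 1; 0, 2] (qForm a) = -qForm a := by
    intro h4
    have h := hp.sum_intSlash_translate m two_ne_zero (h2 2 Nat.prime_two h4)
    have h1 : intSlash m !![2, 0; 0, 2] (qForm a) = qForm a := by
      rw [intSlash_congr m 1 2 one_ne_zero two_ne_zero (B := 1) (by decide), intSlash_one]
    simp only [Finset.sum_range_succ, Finset.sum_range_zero, Nat.cast_ofNat, Nat.cast_zero,
      Nat.cast_one, zero_add, h1] at h
    exact eq_neg_of_add_eq_zero_right h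
  rcases hN with rfl | rfl | rfl
  · refine intSlash_eq_of_level_eighteen hT ?_ hW ?_
    · have h := hp.sum_intSlash_translate m three_ne_zero (h2 3 Nat.prime_three (by norm_num))
      have h1 : intSlash m !![3, 0; 0, 3] (qForm a) = qForm a := by
        rw [intSlash_congr m 1 3 one_ne_zero three_ne_zero (B := 1) (by decide), intSlash_one]
      simpa only [Finset.sum_range_succ, Finset.sum_range_zero, Nat.cast_ofNat, Nat.cast_zero,
        Nat.cast_one, zero_add, h1] using h
    · simpa [Finset.sum_range_succ] using
        hp.sum_intSlash_eq_self hm ha heuler Nat.prime_two (by norm_num) (by norm_num)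
  · exact intSlash_eq_of_level_twenty hm hp.holo hT (hhalf (by norm_num)) hW
      (by simpa [Finset.sum_range_succ] using
        hp.hecke_eigen hm ha heuler Nat.prime_three (by norm_num))
  · exact intSlash_eq_of_level_twentyFour hm hp.holo hT (hhalf (by norm_num)) hW
      (by simpa [Finset.sum_range_succ] using
        hp.hecke_eigen hm ha heuler Nat.prime_five (by norm_num))

end

end HeckeConverse

theorem theorem4 (N : ℕ) (hN : N = 18 ∨ N = 20 ∨ N = 24)
    (k : ℕ) (hk : 0 < k) (hk_even : Even k)
    (a : ℕ → ℂ) (σ : ℝ) (hσ : 0 < σ)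
    (ha : a =O[Filter.atTop] fun n : ℕ => (n : ℝ) ^ σ)
    (heuler : ∀ s : ℂ, σ + 1 < s.re →
      HasProd (fun p : Nat.Primes => eulerFactor N k a p s) (LSeries a s))
    (Λ : ℂ → ℂ)
    (hΛ : ∀ s : ℂ, σ + 1 < s.re → Λ s = gammaC s * LSeries a s)
    (hEBV : IsEBV Λ)
    (hFE : ∀ s : ℂ,
      Λ s = (-1 : ℂ) ^ (k / 2) * (N : ℂ) ^ ((k : ℂ) / 2 - s) * Λ ((k : ℂ) - s)) :
    ∃ F : ModularForm (CongruenceSubgroup.Gamma0 N : Subgroup (GL (Fin 2) ℝ)) (k : ℤ),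
      ∀ z : UpperHalfPlane,
        HasSum (fun n : ℕ+ => a n * Complex.exp (2 * Real.pi * Complex.I * (n : ℕ) * (z : ℂ)))
          (F z) := by
  obtain ⟨m, rfl⟩ := even_iff_exists_two_mul.mp hk_even
  have hm : 0 < m := by omega
  have hN0 : 0 < N := by omega
  -- the value `a 0` plays no role, and is replaced by `0`
  set b := Function.update a 0 0 with hb
  have hab : ∀ {n : ℕ}, n ≠ 0 → b n = a n := fun hn => Function.update_of_ne hn _ _
  have hL : LSeries b = LSeries a := funext fun s => LSeries_congr hab s
  have hb' : b =O[Filter.atTop] fun n : ℕ => (n : ℝ) ^ σ := by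
    refine ha.congr' ?_ .rfl
    filter_upwards [Filter.eventually_ne_atTop 0] with n hn using (hab hn).symm
  have heuler' : ∀ s : ℂ, σ + 1 < s.re →
      HasProd (fun p : Nat.Primes => eulerFactor N (2 * m) b p s) (LSeries b s) := by
    intro s hs
    rw [hL]
    convert heuler s hs using 2 with p
    rw [eulerFactor, eulerFactor, hab p.2.ne_zero]
  have hp := HeckeConverse.polyGrowth_of_isBigO (a := b) (Function.update_self 0 0 a) hb'
  have hW := hp.intSlash_fricke (m := m) hN0 hb' (Λ := Λ) (by rwa [hL]) hEBV fun s => by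
    have := hFE s
    rw [Nat.mul_div_cancel_left m two_pos] at this
    rw [this]
    push_cast
    rw [mul_div_cancel_left₀ (m : ℂ) two_ne_zero]
  obtain ⟨F, hF⟩ := hp.exists_modularForm hN0 (hp.intSlash_eq hN hm hb' heuler' hW)
  refine ⟨F, fun z => ?_⟩
  rw [hF]
  have h := hp.hasSum z.2
  rw [← hasSum_subtype_iff_of_support_subset (s := {n | 0 < n})] at h
  · refine HasSum.congr_fun (g := fun n : ℕ+ => _) h fun n => ?_
    rw [← hab n.ne_zero]
    rfl
  · intro n hn
    refine Nat.pos_of_ne_zero fun h0 => hn ?_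
    simp [h0, b]
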